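/- Let $t,d,k\ge 1$, $m,\zeta\ge 0$ be integers. Consider $t$ noiseless linear regression tasks in $\mathbb R^d$ with $m$ samples each: the covariates $x^{(i)}_j\sim\mathcal N(0,I_d)$ ($i\in[t]$, $j\in[m]$) are independent and $y^{(i)}_j=\langle x^{(i)}_j,\,w^\star u^\star+b^{\star(i)}\rangle$, where $w^\star\in\mathbb R$, $u^\star\in\mathbb R^d$ are arbitrary and the matrix with columns $b^{\star(1)},\dots,b^{\star(t)}$ has at most $k$ non-zero entries in every column and at most $\zeta$ in every row. Fix $c_1,c_2,c_3>0$ and initial error bounds $\alpha^{(0)},\gamma^{(0)},\beta^{(0)},\tau^{(0)}$ that are valid for the zero initialization, i.e. $\max_i\|b^{\star(i)}\|_2\le\alpha^{(0)}\le\sqrt k\,\gamma^{(0)}$, $\max_i\|b^{\star(i)}\|_\infty\le\gamma^{(0)}$, $\|w^\star u^\star\|_\infty\le\beta^{(0)}$ and $\|w^\star u^\star\|_2\le\tau^{(0)}$. The algorithm starts from $u^{(0)}=0$, $b^{(i,0)}=0$ and in iteration $\ell=1,\dots,L$ computes $$\Delta^{(\ell)}=\beta^{(\ell-1)}+\tfrac{c_1}{\sqrt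 k}\big(\tau^{(\ell-1)}+\alpha^{(\ell-1)}\big),$$ $$b^{(i,\ell)}=\mathrm{HT}\Big(b^{(i,\ell-1)}-\tfrac1{|J|}\sum_{j\in J}x^{(i)}_j\big(\langle x^{(i)}_j,u^{(\ell-1)}+b^{(i,\ell-1)}\rangle-y^{(i)}_j\big),\ \Delta^{(\ell)}\Big)\quad(i\in[t]),$$ $$u^{(\ell)}=\Big(\sum_i\sum_{j\in J'}x^{(i)}_j(x^{(i)}_j)^{\mathsf T}\Big)^{-1}\sum_i\sum_{j\in J'}x^{(i)}_j\big(y^{(i)}_j-\langle x^{(i)}_j,b^{(i,\ell)}\rangle\big),$$ $$\gamma^{(\ell)}=2\beta^{(\ell-1)}+\tfrac{2c_1}{\sqrt k}\tau^{(\ell-1)}+2c_1\gamma^{(\ell-1)},\quad \tau^{(\ell)}=c_2\sqrt k\,\gamma^{(\ell)},\quad \beta^{(\ell)}=c_3\gamma^{(\ell)},\quad \alpha^{(\ell)}=\sqrt k\,\gamma^{(\ell)},$$ where $\mathrm{HT}(v,\Delta)$ keeps the entries of $v$ of absolute value larger than $\Delta$ and sets the others to $0$, and where every update uses a fresh batch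 of samples: the $m$ samples of each task are split into $2L$ disjoint batches of size $\lfloor m/(2L)\rfloor$, and $J$, $J'$ are the $(2\ell-1)$-th and the $2\ell$-th of them. There are absolute constants $c_0,c_1,c_2,c_3,C>0$ such that the following holds for all such data, all $\varepsilon_0>0$ and all $\delta_0\in(0,1)$. Assume $\zeta\le c_0t$, let $L\ge 0$ be any integer with $$L\ \ge\ \log\Big(\varepsilon_0^{-1}\Big(\gamma^{(0)}+\beta^{(0)}+\frac{\tau^{(0)}}{\sqrt k}\Big)\Big)$$ (any $L\ge0$ if all three bounds are zero), put $\Lambda=C\,L\,\log(3tdL/\delta_0)$ ($\Lambda=0$ if $L=0$), and assume $$m\ge\Lambda k,\qquad mt\ge\Lambda\,d\sqrt k,\qquad mt^2\ge\Lambda\,\zeta kd .$$ Then with probability at least $1-C\delta_0$, $$\|u^{(L)}-w^\star u^\star\|_\infty\le C\varepsilon_0\quad\text{and}\quad\|b^{(i,L)}-b^{\star(i)}\|_\infty\le C\varepsilon_0\ \text{ for all } i\in[t].$$ In particular, the initial bounds may be the exact initial errors, and then $L$ may be $\log\big(\varepsilon_0^{-1}(\max_i\|b^{\star(i)}\|_\infty+\|w^\star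 u^\star\|_\infty+\|w^\star u^\star\|_2/\sqrt k)\big)$, rounded up to an integer $\ge 0$. No incoherence and no initialization condition is needed. -/

import Mathlib

open scoped Matrix

noncomputable section

namespace SparseFineTuning

/-- Row/column sparsity of the matrix whose `i`-th column is `b i`: every row has at most `ζ`
non-zero entries and every column has at most `k` non-zero entries. -/
def RowColSparse {t d : ℕ} (b : Fin t → Fin d → ℝ) (ζ k : ℕ) : Prop :=
  (∀ s : Fin d, hammingNorm (fun i : Fin t => b i s) ≤ ζ) ∧
  (∀ i : Fin t, hammingNorm (b i) ≤ k)

/-- The Euclidean norm of a vector in `ℝ^d`.  (The norm `‖v‖` of `v : Fin d → ℝ` is the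
`ℓ∞` norm.) -/
def l2norm {d : ℕ} (v : Fin d → ℝ) : ℝ := ‖WithLp.toLp 2 v‖

/-- The law of the covariates: all `x i j`, for `i : Fin t` and `j : Fin m`, are independent
standard Gaussian vectors in `ℝ^d`. -/
def covariateLaw (t m d : ℕ) : MeasureTheory.Measure (Fin t → Fin m → Fin d → ℝ) :=
  MeasureTheory.Measure.pi fun _ : Fin t =>
    MeasureTheory.Measure.pi fun _ : Fin m =>
      MeasureTheory.Measure.pi fun _ : Fin d => ProbabilityTheory.gaussianReal 0 1

/-- The noiseless responses of the rank-one model in which task `i` has the parameter vector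
`w • u + b i`. -/
def responses {t m d : ℕ} (w : ℝ) (u : Fin d → ℝ) (b : Fin t → Fin d → ℝ)
    (x : Fin t → Fin m → Fin d → ℝ) : Fin t → Fin m → ℝ :=
  fun i j => x i j ⬝ᵥ (w • u + b i)

/-- Hard thresholding: keep the entries of absolute value larger than `Δ`. -/
def hardThreshold {d : ℕ} (v : Fin d → ℝ) (Δ : ℝ) : Fin d → ℝ :=
  fun s => if Δ < |v s| then v s else 0

/-- The quantities tracked by the algorithm: upper bounds on the errors of the estimates,
`α` and `γ` in `ℓ2` and `ℓ∞` norm for the sparse vectors, `τ` and `β` in `ℓ2` and `ℓ∞` norm for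
the central vector. -/
structure ErrorBounds where
  α : ℝ
  γ : ℝ
  β : ℝ
  τ : ℝ

/-- `E` bounds the errors of the estimates `u`, `b` of `ustar`, `bstar`. -/
def ErrorBounds.Valid {t d : ℕ} (E : ErrorBounds) (u : Fin d → ℝ) (b : Fin t → Fin d → ℝ)
    (ustar : Fin d → ℝ) (bstar : Fin t → Fin d → ℝ) : Prop :=
  (∀ i, l2norm (b i - bstar i) ≤ E.α) ∧ (∀ i, ‖b i - bstar i‖ ≤ E.γ) ∧
  ‖u - ustar‖ ≤ E.β ∧ l2norm (u - ustar) ≤ E.τ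

/-- The threshold of an iteration that starts with the error bounds `E`. -/
def ErrorBounds.threshold (c₁ : ℝ) (k : ℕ) (E : ErrorBounds) : ℝ :=
  E.β + c₁ / √(k : ℝ) * (E.τ + E.α)

/-- The bound `γ` at the end of an iteration that starts with the error bounds `E`. -/
def ErrorBounds.nextGamma (c₁ : ℝ) (k : ℕ) (E : ErrorBounds) : ℝ :=
  2 * E.β + 2 * c₁ / √(k : ℝ) * E.τ + 2 * c₁ * E.γ

/-- The update of the error bounds in one iteration. -/
def ErrorBounds.next (c₁ c₂ c₃ : ℝ) (k : ℕ) (E : ErrorBounds) : ErrorBounds where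
  α := √(k : ℝ) * E.nextGamma c₁ k
  γ := E.nextGamma c₁ k
  β := c₃ * E.nextGamma c₁ k
  τ := c₂ * √(k : ℝ) * E.nextGamma c₁ k

/-- One gradient step for a sparse vector of one task, on the samples with index in `J`. -/
def gradientStep {m d : ℕ} (J : Finset (Fin m)) (x : Fin m → Fin d → ℝ) (y : Fin m → ℝ)
    (u b : Fin d → ℝ) : Fin d → ℝ :=
  b - (J.card : ℝ)⁻¹ • ∑ j ∈ J, (x j ⬝ᵥ (u + b) - y j) • x j

/-- The least squares update of the central vector, on the samples of all tasks with index
in `J`. -/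
def leastSquares {t m d : ℕ} (J : Finset (Fin m)) (x : Fin t → Fin m → Fin d → ℝ)
    (y : Fin t → Fin m → ℝ) (b : Fin t → Fin d → ℝ) : Fin d → ℝ :=
  (∑ i, ∑ j ∈ J, Matrix.vecMulVec (x i j) (x i j))⁻¹ *ᵥ
    ∑ i, ∑ j ∈ J, (y i j - x i j ⬝ᵥ b i) • x i j

/-- The `m` samples of each task are split into `2 * L` disjoint consecutive batches of size
`⌊m / (2 * L)⌋`; this is the set of indices of the `q`-th batch, `q = 0, …, 2 * L - 1`. -/
def batch (m L q : ℕ) : Finset (Fin m) :=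
  Finset.univ.filter fun j => q * (m / (2 * L)) ≤ (j : ℕ) ∧ (j : ℕ) < (q + 1) * (m / (2 * L))

/-- The variables of the algorithm: the estimates `u`, `b` and the current error bounds. -/
structure State (t d : ℕ) where
  u : Fin d → ℝ
  b : Fin t → Fin d → ℝ
  bounds : ErrorBounds

/-- The state after `ℓ` of the `L` iterations of the alternating algorithm, run from zero
initialization on the data `x`, `y`.  Each of the two updates of an iteration uses a fresh
batch of samples. -/
def iterate {t m d : ℕ} (c₁ c₂ c₃ : ℝ) (k L : ℕ) (E₀ : ErrorBounds)
    (x : Fin t → Fin m → Fin d → ℝ) (y : Fin t → Fin m → ℝ) : ℕ → State t d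
  | 0 => { u := 0, b := 0, bounds := E₀ }
  | ℓ + 1 =>
    let S := iterate c₁ c₂ c₃ k L E₀ x y ℓ
    let b' : Fin t → Fin d → ℝ := fun i =>
      hardThreshold (gradientStep (batch m L (2 * ℓ)) (x i) (y i) S.u (S.b i))
        (S.bounds.threshold c₁ k)
    { u := leastSquares (batch m L (2 * ℓ + 1)) x y b'
      b := b'
      bounds := S.bounds.next c₁ c₂ c₃ k }

end SparseFineTuning

end

noncomputable section

namespace SparseFineTuning

open MeasureTheory ProbabilityTheory

/-! Each batch is independent of everything computed before it, so in every update the current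
errors act as fixed vectors, and only deviations of Gaussian bilinear forms `∑ ⟨x, p⟩⟨x, q⟩` from
their means matter. These are subexponential (`bilinear_tail`), and `fresh_bilinear_tail` transfers
the bound to vectors `q` computed from other samples.

Gradient step. With `e = (u - us) + (b - bs)`, the new error in coordinate `s` is `-(u - us) s`
minus an average of `x s * ⟨x, e⟩ - e s`. Of order `k` samples per task, up to logarithms, bring
this average below `c₁ / √k * (τ + α)`, so the total error is below the threshold. Hard thresholding
then creates no false support and costs only a factor 2 (`gradient_update_error`).

Least squares. The error of the central vector is `G⁻¹` applied to a sum of responses to the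
residuals `bs i - b i`, where `G` is the Gram matrix. The task mean of the residuals passes through
unchanged; row sparsity makes it at most `ζ / t * γ` entrywise. The centred residuals contribute
only a fluctuation `σ` per coordinate. As `G / N = 1 + M` with `M` of small operator norm `η`, the
remaining error `z` satisfies `z = g - M z` with `|g s| ≤ σ`, so its entries are at most `σ + 2 η √d
σ`. The product `η √d σ` is of order `d √k γ / N` up to logarithms, and this is why `d √k` samples
in total suffice (`leastSquares_update_error`).

From the second iteration on, the bounds shrink by `2 c₃ + 2 c₁ c₂ + 2 c₁ = 5/16 < 1/e`
(`nextGamma_iterate_le`). A union bound gives failure probability `4 δ / L` per iteration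
(`exists_bad_event`). -/

lemma l2norm_sq {d : ℕ} (v : Fin d → ℝ) : l2norm v ^ 2 = v ⬝ᵥ v := by
  rw [l2norm, EuclideanSpace.norm_sq_eq]
  simp [dotProduct, sq]

lemma l2norm_nonneg {d : ℕ} (v : Fin d → ℝ) : 0 ≤ l2norm v := norm_nonneg _

/-! ### Exponential moments of squared Gaussian linear forms. -/

/-- The moment generating function of the centred square of a standard Gaussian variable. -/
lemma mgf_sq_gaussian {l : ℝ} (hl : |l| ≤ 1 / 8) :
    Integrable (fun z : ℝ => Real.exp (l * (z ^ 2 - 1))) (gaussianReal 0 1) ∧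
      ∫ z, Real.exp (l * (z ^ 2 - 1)) ∂(gaussianReal 0 1) ≤ Real.exp (2 * l ^ 2) := by
  have hl' := abs_le.mp hl
  have hb : 0 < 1 / 2 - l := by linarith
  have key : ∀ z : ℝ, gaussianPDFReal 0 1 z • Real.exp (l * (z ^ 2 - 1)) =
      ((√(2 * Real.pi))⁻¹ * Real.exp (-l)) * Real.exp (-(1 / 2 - l) * z ^ 2) := by
    intro z
    simp only [gaussianPDFReal, smul_eq_mul, NNReal.coe_one, mul_one, sub_zero]
    rw [mul_assoc, mul_assoc, ← Real.exp_add, ← Real.exp_add]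
    congr 2
    ring
  constructor
  · rw [gaussianReal_of_var_ne_zero 0 one_ne_zero]
    rw [integrable_withDensity_iff_integrable_smul' (measurable_gaussianPDF 0 1)
      (Filter.Eventually.of_forall fun _ => gaussianPDF_lt_top)]
    simp only [toReal_gaussianPDF, key]
    exact (integrable_exp_neg_mul_sq hb).const_mul _
  · rw [integral_gaussianReal_eq_integral_smul one_ne_zero]
    simp only [key]
    rw [integral_const_mul, integral_gaussian]
    -- With `x = 2 * l`, Taylor's formula gives `log (1 - x) ≥ -x - x² / 2 - |x|³ / (1 - |x|)`, and
    -- the last term is at most `x² / 2` for `|x| ≤ 1/4`.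
    have h2 : Real.exp (-(2 * l) - (2 * l) ^ 2) ≤ 1 - 2 * l := by
      have h4 : |2 * l| ≤ 1 / 4 := by rw [abs_le]; constructor <;> linarith
      have h3 := Real.abs_log_sub_add_sum_range_le (x := 2 * l) (by linarith) 2
      have h5 : |2 * l| ^ (2 + 1) / (1 - |2 * l|) ≤ (2 * l) ^ 2 / 2 := by
        rw [div_le_iff₀ (by linarith), ← sq_abs (2 * l)]
        nlinarith [sq_nonneg |2 * l|, abs_nonneg (2 * l)]
      have h6 := (abs_le.mp (h3.trans h5)).1
      norm_num [Finset.sum_range_succ] at h6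
      rw [← Real.le_log_iff_exp_le (by linarith)]
      linarith
    have h7 : √(Real.pi / (1 / 2 - l)) = √(2 * Real.pi) * √((1 - 2 * l)⁻¹) := by
      rw [← Real.sqrt_mul (by positivity)]
      congr 1
      field_simp
    rw [h7]
    have h8 : √(2 * Real.pi) ≠ 0 := by positivity
    have h9 : √((1 - 2 * l)⁻¹) ≤ Real.exp (l + 2 * l ^ 2) := by
      rw [Real.sqrt_le_left (by positivity), ← Real.exp_nat_mul]
      rw [inv_le_comm₀ (by linarith) (by positivity), ← Real.exp_neg]
      refine le_trans (le_of_eq ?_) h2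
      congr 1
      push_cast
      ring
    calc (√(2 * Real.pi))⁻¹ * Real.exp (-l) * (√(2 * Real.pi) * √((1 - 2 * l)⁻¹))
        = Real.exp (-l) * √((1 - 2 * l)⁻¹) := by field_simp
      _ ≤ Real.exp (-l) * Real.exp (l + 2 * l ^ 2) := by gcongr
      _ = _ := by rw [← Real.exp_add]; congr 1; ring

/-- The standard Gaussian law on `ℝ^d`. -/
abbrev gaussianVec (d : ℕ) : Measure (Fin d → ℝ) := Measure.pi fun _ : Fin d => gaussianReal 0 1

/-- Rotation invariance. Writing the law as a scaled standard Gaussian, not as a Gaussian of given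
variance, lets `mgf_sq_gaussian` apply directly, also for `r = 0`. -/
lemma map_dotProduct_gaussianVec {d : ℕ} (r : Fin d → ℝ) :
    (gaussianVec d).map (fun x => x ⬝ᵥ r) = (gaussianReal 0 1).map (fun z => l2norm r * z) := by
  have h := IsGaussian.map_eq_gaussianReal (μ := stdGaussian (EuclideanSpace ℝ (Fin d)))
    (innerSL ℝ (WithLp.toLp 2 r))
  rw [integral_strongDual_stdGaussian, variance_dual_stdGaussian, ← map_pi_eq_stdGaussian,
    Measure.map_map (by fun_prop) (by fun_prop)] at h
  rw [gaussianReal_map_const_mul]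
  convert h using 2
  · ext x
    simp [EuclideanSpace.inner_eq_star_dotProduct]
  · simp
  · ext
    simp [l2norm]

lemma mgf_dotProduct_sq {d : ℕ} (r : Fin d → ℝ) {l : ℝ} (hl : |l| * (r ⬝ᵥ r) ≤ 1 / 8) :
    Integrable (fun x => Real.exp (l * ((x ⬝ᵥ r) ^ 2 - r ⬝ᵥ r))) (gaussianVec d) ∧
      ∫ x, Real.exp (l * ((x ⬝ᵥ r) ^ 2 - r ⬝ᵥ r)) ∂(gaussianVec d) ≤
        Real.exp (2 * l ^ 2 * (r ⬝ᵥ r) ^ 2) := by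
  have hm : Measurable fun x : Fin d → ℝ => x ⬝ᵥ r := by
    unfold dotProduct; fun_prop
  have hg : Measurable fun z : ℝ => Real.exp (l * (z ^ 2 - r ⬝ᵥ r)) := by fun_prop
  have h0 := mgf_sq_gaussian (l := l * (r ⬝ᵥ r)) (by
    rw [abs_mul, abs_of_nonneg (a := r ⬝ᵥ r) (by rw [← l2norm_sq]; positivity)]; exact hl)
  have he : (fun z : ℝ => Real.exp (l * (r ⬝ᵥ r) * (z ^ 2 - 1))) =
      (fun z : ℝ => Real.exp (l * (z ^ 2 - r ⬝ᵥ r))) ∘ fun z => l2norm r * z := by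
    ext z
    simp only [Function.comp, mul_pow, l2norm_sq]
    congr 1
    ring
  constructor
  · have : Integrable (fun z : ℝ => Real.exp (l * (z ^ 2 - r ⬝ᵥ r)))
        ((gaussianVec d).map (fun x => x ⬝ᵥ r)) := by
      rw [map_dotProduct_gaussianVec, integrable_map_measure hg.aestronglyMeasurable (by fun_prop),
        ← he]
      exact h0.1
    exact (integrable_map_measure hg.aestronglyMeasurable hm.aemeasurable).mp this
  · have : ∫ x, Real.exp (l * ((x ⬝ᵥ r) ^ 2 - r ⬝ᵥ r)) ∂(gaussianVec d) =
        ∫ z, Real.exp (l * (z ^ 2 - r ⬝ᵥ r)) ∂((gaussianVec d).map (fun x => x ⬝ᵥ r)) := by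
      rw [integral_map hm.aemeasurable hg.aestronglyMeasurable]
    rw [this, map_dotProduct_gaussianVec, integral_map (by fun_prop) hg.aestronglyMeasurable]
    have h1 := h0.2
    rw [he] at h1
    refine h1.trans (le_of_eq ?_)
    congr 1
    ring

/-! ### Chernoff bounds for quadratic and bilinear forms. -/

section concentration

variable {Ω ι : Type*} [MeasurableSpace Ω] {μ : Measure Ω} [IsProbabilityMeasure μ] {d : ℕ}
  {X : ι → Ω → Fin d → ℝ}

/-- One-sided deviations of `±` quadratic forms of independent Gaussian vectors. -/
lemma quadratic_tail_aux (hX : iIndepFun X μ) (hm : ∀ a, Measurable (X a))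
    (hlaw : ∀ a, μ.map (X a) = gaussianVec d) (S : Finset ι) (r : ι → Fin d → ℝ)
    (hr : ∀ a ∈ S, r a ⬝ᵥ r a ≤ 4) {θ : ℝ} (h0 : 0 ≤ θ) (h1 : θ ≤ 1) {σ : ℝ} (hσ : |σ| = 1) :
    μ.real {ω | 2 * θ * S.card ≤ ∑ a ∈ S, σ * ((X a ω ⬝ᵥ r a) ^ 2 - r a ⬝ᵥ r a)} ≤
      Real.exp (-(θ ^ 2 * S.card / 32)) := by
  set Y : ι → Ω → ℝ := fun a ω => σ * ((X a ω ⬝ᵥ r a) ^ 2 - r a ⬝ᵥ r a) with hY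
  have hf : ∀ a, Measurable fun x : Fin d → ℝ => σ * ((x ⬝ᵥ r a) ^ 2 - r a ⬝ᵥ r a) := by
    intro a; unfold dotProduct; fun_prop
  have hYm : ∀ a, Measurable (Y a) := fun a => (hf a).comp (hm a)
  have hYi : iIndepFun Y μ := hX.comp _ hf
  have hσ2 : σ ^ 2 = 1 := by rw [← sq_abs, hσ]; norm_num
  -- The parameter `θ / 32` is admissible because `r a ⬝ᵥ r a ≤ 4` and `θ ≤ 1`. The Chernoff
  -- exponent per sample is then `-θ² / 16 + θ² / 32`.
  have hmg : ∀ a ∈ S, Integrable (fun ω => Real.exp (θ / 32 * Y a ω)) μ ∧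
      mgf (Y a) μ (θ / 32) ≤ Real.exp (θ ^ 2 / 32) := by
    intro a ha
    have hrn : 0 ≤ r a ⬝ᵥ r a := by rw [← l2norm_sq]; positivity
    have h := mgf_dotProduct_sq (r a) (l := θ / 32 * σ) (by
      rw [abs_mul, hσ, abs_of_nonneg (by positivity)]
      have := hr a ha
      nlinarith)
    have hg : Measurable fun x : Fin d → ℝ =>
        Real.exp (θ / 32 * σ * ((x ⬝ᵥ r a) ^ 2 - r a ⬝ᵥ r a)) := by
      unfold dotProduct; fun_prop
    rw [← hlaw a, integral_map (hm a).aemeasurable hg.aestronglyMeasurable,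
      integrable_map_measure hg.aestronglyMeasurable (hm a).aemeasurable] at h
    simp only [mul_assoc, Function.comp_def] at h
    refine ⟨by simpa only [hY] using h.1, ?_⟩
    unfold mgf
    refine (le_trans (by simpa only [hY] using h.2)) (Real.exp_le_exp.mpr ?_)
    have := hr a ha
    have h16 : (r a ⬝ᵥ r a) ^ 2 ≤ 16 := by nlinarith
    have : (θ / 32 * σ) ^ 2 = θ ^ 2 / 1024 := by rw [mul_pow, hσ2]; ring
    rw [this]
    nlinarith [sq_nonneg θ]
  have hint := hYi.integrable_exp_mul_sum hYm (s := S) (t := θ / 32) (fun a ha => (hmg a ha).1)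
  have hc := measure_ge_le_exp_mul_mgf (μ := μ) (X := ∑ a ∈ S, Y a) (2 * θ * S.card)
    (t := θ / 32) (by positivity) hint
  rw [hYi.mgf_sum hYm] at hc
  have hprod : ∏ a ∈ S, mgf (Y a) μ (θ / 32) ≤ Real.exp (θ ^ 2 / 32 * S.card) := by
    calc _ ≤ ∏ a ∈ S, Real.exp (θ ^ 2 / 32) :=
          Finset.prod_le_prod (fun a _ => mgf_nonneg) (fun a ha => (hmg a ha).2)
      _ = _ := by rw [Finset.prod_const, ← Real.exp_nat_mul]; congr 1; ring
  simp only [Finset.sum_apply] at hc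
  refine hc.trans ?_
  refine (mul_le_mul_of_nonneg_left hprod (Real.exp_nonneg _)).trans (le_of_eq ?_)
  rw [← Real.exp_add]
  congr 1
  ring

/-- Polarization: `⟨x, p⟩⟨x, q⟩` is `ρ / 4` times the difference of the squares of `⟨x, p ± q / ρ⟩`,
and the parallelogram law bounds both squared norms by 4. Two signs and two tails give the factor 4.
-/
lemma bilinear_tail (hX : iIndepFun X μ) (hm : ∀ a, Measurable (X a))
    (hlaw : ∀ a, μ.map (X a) = gaussianVec d) (S : Finset ι) (p q : ι → Fin d → ℝ) {ρ : ℝ}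
    (hρ : 0 ≤ ρ) (hp : ∀ a ∈ S, p a ⬝ᵥ p a ≤ 1) (hq : ∀ a ∈ S, q a ⬝ᵥ q a ≤ ρ ^ 2)
    {θ : ℝ} (h0 : 0 ≤ θ) (h1 : θ ≤ 1) :
    μ.real {ω | θ * ρ * S.card <
        |∑ a ∈ S, ((X a ω ⬝ᵥ p a) * (X a ω ⬝ᵥ q a) - p a ⬝ᵥ q a)|} ≤
      4 * Real.exp (-(θ ^ 2 * S.card / 32)) := by
  rcases hρ.eq_or_lt with rfl | hρ
  · have hq0 : ∀ a ∈ S, q a = 0 := by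
      intro a ha
      have := hq a ha
      have h2 : 0 ≤ q a ⬝ᵥ q a := by rw [← l2norm_sq]; positivity
      exact dotProduct_self_eq_zero.mp (by linarith)
    have : {ω | θ * 0 * S.card <
        |∑ a ∈ S, ((X a ω ⬝ᵥ p a) * (X a ω ⬝ᵥ q a) - p a ⬝ᵥ q a)|} = ∅ := by
      refine Set.eq_empty_of_forall_notMem fun ω hω => ?_
      rw [Set.mem_ofPred_eq, Finset.sum_eq_zero (fun a ha => by simp [hq0 a ha])] at hω
      simp at hω
    rw [this]
    simp
    positivity
  set r : ℝ → ι → Fin d → ℝ := fun τ a => p a + (τ * ρ⁻¹) • q a with hr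
  have hexp : ∀ τ a, r τ a ⬝ᵥ r τ a =
      p a ⬝ᵥ p a + 2 * (τ * ρ⁻¹) * (p a ⬝ᵥ q a) + (τ * ρ⁻¹) ^ 2 * (q a ⬝ᵥ q a) := by
    intro τ a
    simp only [hr, add_dotProduct, dotProduct_add, smul_dotProduct, dotProduct_smul, smul_eq_mul,
      dotProduct_comm (q a) (p a)]
    ring
  have hbound : ∀ τ : ℝ, |τ| = 1 → ∀ a ∈ S, r τ a ⬝ᵥ r τ a ≤ 4 := by
    intro τ hτ a ha
    have hτ2 : τ ^ 2 = 1 := by rw [← sq_abs, hτ]; norm_num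
    have hn : 0 ≤ r (-τ) a ⬝ᵥ r (-τ) a := by rw [← l2norm_sq]; positivity
    rw [hexp] at hn ⊢
    have h3 : (τ * ρ⁻¹) ^ 2 * (q a ⬝ᵥ q a) ≤ 1 := by
      rw [mul_pow, hτ2, one_mul, inv_pow, inv_mul_le_iff₀ (by positivity), mul_one]
      exact hq a ha
    have h4 : (-τ * ρ⁻¹) ^ 2 * (q a ⬝ᵥ q a) ≤ 1 := by
      rw [neg_mul, neg_sq]; exact h3
    have := hp a ha
    nlinarith
  set E : ℝ → ℝ → Set Ω := fun τ σ =>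
    {ω | 2 * θ * S.card ≤ ∑ a ∈ S, σ * ((X a ω ⬝ᵥ r τ a) ^ 2 - r τ a ⬝ᵥ r τ a)} with hE
  have hEb : ∀ τ σ : ℝ, |τ| = 1 → |σ| = 1 → μ.real (E τ σ) ≤
      Real.exp (-(θ ^ 2 * S.card / 32)) := fun τ σ hτ hσ =>
    quadratic_tail_aux hX hm hlaw S (r τ) (hbound τ hτ) h0 h1 hσ
  have hsub : {ω | θ * ρ * S.card <
        |∑ a ∈ S, ((X a ω ⬝ᵥ p a) * (X a ω ⬝ᵥ q a) - p a ⬝ᵥ q a)|} ⊆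
      (E 1 1 ∪ E 1 (-1)) ∪ (E (-1) 1 ∪ E (-1) (-1)) := by
    intro ω hω
    by_contra hc
    simp only [hE, Set.mem_union, Set.mem_ofPred_eq, not_or, not_le, ← Finset.mul_sum] at hc
    obtain ⟨⟨h1, h2⟩, h3, h4⟩ := hc
    have hid : ∑ a ∈ S, ((X a ω ⬝ᵥ p a) * (X a ω ⬝ᵥ q a) - p a ⬝ᵥ q a) = ρ / 4 *
        (∑ a ∈ S, ((X a ω ⬝ᵥ r 1 a) ^ 2 - r 1 a ⬝ᵥ r 1 a) -
          ∑ a ∈ S, ((X a ω ⬝ᵥ r (-1) a) ^ 2 - r (-1) a ⬝ᵥ r (-1) a)) := by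
      rw [← Finset.sum_sub_distrib, Finset.mul_sum]
      refine Finset.sum_congr rfl fun a _ => ?_
      rw [hexp, hexp]
      simp only [hr, dotProduct_add, dotProduct_smul, smul_eq_mul]
      field_simp
      ring
    rw [Set.mem_ofPred_eq, hid, abs_mul, abs_of_pos (by positivity)] at hω
    have : |∑ a ∈ S, ((X a ω ⬝ᵥ r 1 a) ^ 2 - r 1 a ⬝ᵥ r 1 a) -
          ∑ a ∈ S, ((X a ω ⬝ᵥ r (-1) a) ^ 2 - r (-1) a ⬝ᵥ r (-1) a)| ≤ 4 * (θ * S.card) := by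
      rw [abs_le]; constructor <;> linarith
    have := mul_le_mul_of_nonneg_left this (show 0 ≤ ρ / 4 by positivity)
    linarith
  have hone : |(1 : ℝ)| = 1 := abs_one
  have hneg : |(-1 : ℝ)| = 1 := by simp
  calc _ ≤ μ.real ((E 1 1 ∪ E 1 (-1)) ∪ (E (-1) 1 ∪ E (-1) (-1))) := measureReal_mono hsub
    _ ≤ (μ.real (E 1 1) + μ.real (E 1 (-1))) + (μ.real (E (-1) 1) + μ.real (E (-1) (-1))) := by
      refine (measureReal_union_le _ _).trans (add_le_add ?_ ?_) <;> exact measureReal_union_le _ _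
    _ ≤ _ := by
      linarith [hEb 1 1 hone hone, hEb 1 (-1) hone hneg, hEb (-1) 1 hneg hone,
        hEb (-1) (-1) hneg hneg]

end concentration

/-! ### Independence of disjoint sets of samples. -/

section law

variable {t m d : ℕ}

instance : IsProbabilityMeasure (covariateLaw t m d) := by
  unfold covariateLaw; infer_instance

lemma iIndepFun_covariates :
    iIndepFun (fun (a : Fin t × Fin m) (x : Fin t → Fin m → Fin d → ℝ) => x a.1 a.2)
      (covariateLaw t m d) := by
  have h := iIndepFun_uncurry_infinitePi' (Ω := fun (_ : Fin t) (_ : Fin m) => Fin d → ℝ)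
    (X := fun _ _ v => v) (fun _ _ => gaussianVec d) (fun _ _ => measurable_id)
  simp only [Measure.infinitePi_eq_pi] at h
  exact h

lemma map_covariate (a : Fin t × Fin m) :
    (covariateLaw t m d).map (fun x => x a.1 a.2) = gaussianVec d := by
  have h1 := (measurePreserving_eval (fun _ : Fin t =>
    Measure.pi fun _ : Fin m => gaussianVec d) a.1).map_eq
  have h2 := (measurePreserving_eval (fun _ : Fin m => gaussianVec d) a.2).map_eq
  rw [← h1, Measure.map_map (by fun_prop) (by fun_prop)] at h2
  exact h2

/-- Replace the samples with index outside `J` by `0`. -/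
def mask (J : Finset (Fin m)) (x : Fin t → Fin m → Fin d → ℝ) : Fin t → Fin m → Fin d → ℝ :=
  fun i j => if j ∈ J then x i j else 0

lemma mask_apply_of_mem {J : Finset (Fin m)} {j : Fin m} (hj : j ∈ J)
    (x : Fin t → Fin m → Fin d → ℝ) (i : Fin t) : mask J x i j = x i j := if_pos hj

lemma measurable_mask (J : Finset (Fin m)) :
    Measurable (mask J : (Fin t → Fin m → Fin d → ℝ) → Fin t → Fin m → Fin d → ℝ) := by
  refine measurable_pi_iff.mpr fun i => measurable_pi_iff.mpr fun j => ?_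
  unfold mask
  split_ifs <;> fun_prop

lemma indepFun_mask {J J' : Finset (Fin m)} (hJ : Disjoint J J') :
    IndepFun (mask J) (mask J') (covariateLaw t m d) := by
  classical
  have h := (iIndepFun_covariates (t := t) (m := m) (d := d)).indepFun_finset
    (Finset.univ ×ˢ J) (Finset.univ ×ˢ J')
    (Finset.disjoint_product.mpr (Or.inr hJ)) (fun a => by fun_prop)
  have key : ∀ K : Finset (Fin m), ∃ φ : ((↥((Finset.univ : Finset (Fin t)) ×ˢ K)) → Fin d → ℝ) →
      Fin t → Fin m → Fin d → ℝ, Measurable φ ∧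
        (mask K : (Fin t → Fin m → Fin d → ℝ) → _) = φ ∘ fun x a => x a.1.1 a.1.2 := by
    intro K
    refine ⟨fun v i j => if hj : j ∈ K then v ⟨(i, j), by simp [hj]⟩ else 0, ?_, ?_⟩
    · refine measurable_pi_iff.mpr fun i => measurable_pi_iff.mpr fun j => ?_
      by_cases hj : j ∈ K
      · simp only [hj, dite_true]; fun_prop
      · simp only [hj, dite_false]; fun_prop
    · ext x i j s
      by_cases hj : j ∈ K <;> simp [mask, hj]
  obtain ⟨φ, hφ, hφe⟩ := key J
  obtain ⟨ψ, hψ, hψe⟩ := key J'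
  rw [hφe, hψe]
  exact h.comp hφ hψ

/-- A bound on the probability of an event about fresh samples that holds for each fixed value
of the earlier samples. -/
lemma measure_le_of_fresh {J J' : Finset (Fin m)} (hJ : Disjoint J J')
    {B : Set ((Fin t → Fin m → Fin d → ℝ) × (Fin t → Fin m → Fin d → ℝ))} (hB : MeasurableSet B)
    (hdep : ∀ x y, (x, y) ∈ B ↔ (mask J x, mask J' y) ∈ B) {ε : ℝ} (hε : 0 ≤ ε)
    (h : ∀ y, (covariateLaw t m d).real {x | (y, x) ∈ B} ≤ ε) :
    (covariateLaw t m d).real {x | (x, x) ∈ B} ≤ ε := by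
  set μ := covariateLaw t m d
  have hm : Measurable fun x : Fin t → Fin m → Fin d → ℝ => (mask J x, mask J' x) :=
    (measurable_mask J).prodMk (measurable_mask J')
  have h1 : μ {x | (x, x) ∈ B} = (μ.map fun x => (mask J x, mask J' x)) B := by
    rw [Measure.map_apply hm hB]
    congr 1
    ext x
    exact hdep x x
  have hpj : IsProbabilityMeasure (μ.map (mask J)) :=
    Measure.isProbabilityMeasure_map (measurable_mask J).aemeasurable
  have hpj' : IsProbabilityMeasure (μ.map (mask J')) :=
    Measure.isProbabilityMeasure_map (measurable_mask J').aemeasurable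
  -- By independence the joint law of the two masked samples is a product, so Fubini reduces the
  -- claim to fixed earlier samples.
  rw [(indepFun_iff_map_prod_eq_prod_map_map (measurable_mask J).aemeasurable
    (measurable_mask J').aemeasurable).mp (indepFun_mask hJ), Measure.prod_apply hB,
    lintegral_map (measurable_measure_prodMk_left hB) (measurable_mask J)] at h1
  have h2 : ∀ x, (μ.map (mask J')) (Prod.mk (mask J x) ⁻¹' B) ≤ ENNReal.ofReal ε := by
    intro x
    rw [Measure.map_apply (measurable_mask J') (measurable_prodMk_left hB)]
    have : mask J' ⁻¹' (Prod.mk (mask J x) ⁻¹' B) = {y | (x, y) ∈ B} := by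
      ext y
      exact (hdep x y).symm
    rw [this]
    have := h x
    rw [measureReal_def] at this
    exact (ENNReal.le_ofReal_iff_toReal_le (measure_ne_top _ _) hε).mpr this
  rw [measureReal_def]
  refine ENNReal.toReal_le_of_le_ofReal hε ?_
  rw [h1]
  refine (lintegral_mono h2).trans (le_of_eq ?_)
  simp

end law

/-! ### Which samples an iterate depends on, and measurability. -/

section algorithm

variable {t m d : ℕ} {c₁ c₂ c₃ : ℝ} {k L : ℕ} {E₀ : ErrorBounds} {w : ℝ} {ustar : Fin d → ℝ}
  {bstar : Fin t → Fin d → ℝ}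

lemma iterate_bounds (x : Fin t → Fin m → Fin d → ℝ) (y : Fin t → Fin m → ℝ) (ℓ : ℕ) :
    (iterate c₁ c₂ c₃ k L E₀ x y ℓ).bounds = (ErrorBounds.next c₁ c₂ c₃ k)^[ℓ] E₀ := by
  induction ℓ with
  | zero => rfl
  | succ ℓ ih => rw [Function.iterate_succ_apply', ← ih]; rfl

lemma gradientStep_congr {J : Finset (Fin m)} {x x' : Fin m → Fin d → ℝ} {y y' : Fin m → ℝ}
    (hx : ∀ j ∈ J, x j = x' j) (hy : ∀ j ∈ J, y j = y' j) (u b : Fin d → ℝ) :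
    gradientStep J x y u b = gradientStep J x' y' u b := by
  unfold gradientStep
  congr 2
  exact Finset.sum_congr rfl fun j hj => by rw [hx j hj, hy j hj]

lemma leastSquares_congr {J : Finset (Fin m)} {x x' : Fin t → Fin m → Fin d → ℝ}
    {y y' : Fin t → Fin m → ℝ} (hx : ∀ i, ∀ j ∈ J, x i j = x' i j)
    (hy : ∀ i, ∀ j ∈ J, y i j = y' i j) (b : Fin t → Fin d → ℝ) :
    leastSquares J x y b = leastSquares J x' y' b := by
  unfold leastSquares
  congr 2
  · exact Finset.sum_congr rfl fun i _ => Finset.sum_congr rfl fun j hj => by rw [hx i j hj]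
  · funext i
    exact Finset.sum_congr rfl fun j hj => by rw [hx i j hj, hy i j hj]

/-- The run of the algorithm on the responses of the rank-one model. -/
abbrev run (c₁ c₂ c₃ : ℝ) (k L : ℕ) (E₀ : ErrorBounds) (w : ℝ) (ustar : Fin d → ℝ)
    (bstar : Fin t → Fin d → ℝ) (x : Fin t → Fin m → Fin d → ℝ) (ℓ : ℕ) : State t d :=
  iterate c₁ c₂ c₃ k L E₀ x (responses w ustar bstar x) ℓ

lemma run_b_succ (x : Fin t → Fin m → Fin d → ℝ) (ℓ : ℕ) (i : Fin t) :
    (run c₁ c₂ c₃ k L E₀ w ustar bstar x (ℓ + 1)).b i =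
      hardThreshold (gradientStep (batch m L (2 * ℓ)) (x i) (responses w ustar bstar x i)
        (run c₁ c₂ c₃ k L E₀ w ustar bstar x ℓ).u ((run c₁ c₂ c₃ k L E₀ w ustar bstar x ℓ).b i))
        (((ErrorBounds.next c₁ c₂ c₃ k)^[ℓ] E₀).threshold c₁ k) := by
  rw [← iterate_bounds x (responses w ustar bstar x)]
  rfl

lemma run_u_succ (x : Fin t → Fin m → Fin d → ℝ) (ℓ : ℕ) :
    (run c₁ c₂ c₃ k L E₀ w ustar bstar x (ℓ + 1)).u =
      leastSquares (batch m L (2 * ℓ + 1)) x (responses w ustar bstar x)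
        (run c₁ c₂ c₃ k L E₀ w ustar bstar x (ℓ + 1)).b := rfl

/-- Kept apart from `run_mask` because the least squares update needs the half-step: the new sparse
vectors do not involve batch `2 * ℓ + 1`. -/
lemma run_b_mask_succ {J : Finset (Fin m)} {ℓ : ℕ} (hJ : batch m L (2 * ℓ) ⊆ J)
    (x : Fin t → Fin m → Fin d → ℝ)
    (hu : (run c₁ c₂ c₃ k L E₀ w ustar bstar (mask J x) ℓ).u =
      (run c₁ c₂ c₃ k L E₀ w ustar bstar x ℓ).u)
    (hb : (run c₁ c₂ c₃ k L E₀ w ustar bstar (mask J x) ℓ).b =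
      (run c₁ c₂ c₃ k L E₀ w ustar bstar x ℓ).b) :
    (run c₁ c₂ c₃ k L E₀ w ustar bstar (mask J x) (ℓ + 1)).b =
      (run c₁ c₂ c₃ k L E₀ w ustar bstar x (ℓ + 1)).b := by
  funext i
  rw [run_b_succ, run_b_succ, hu, hb]
  congr 1
  refine gradientStep_congr (fun j hj => mask_apply_of_mem (hJ hj) x i) (fun j hj => ?_) _ _
  simp only [responses, mask_apply_of_mem (hJ hj)]

lemma run_mask {J : Finset (Fin m)} {ℓ : ℕ} (hJ : ∀ q < 2 * ℓ, batch m L q ⊆ J)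
    (x : Fin t → Fin m → Fin d → ℝ) :
    (run c₁ c₂ c₃ k L E₀ w ustar bstar (mask J x) ℓ).u =
        (run c₁ c₂ c₃ k L E₀ w ustar bstar x ℓ).u ∧
      (run c₁ c₂ c₃ k L E₀ w ustar bstar (mask J x) ℓ).b =
        (run c₁ c₂ c₃ k L E₀ w ustar bstar x ℓ).b := by
  induction ℓ with
  | zero => exact ⟨rfl, rfl⟩
  | succ ℓ ih =>
    obtain ⟨hu, hb⟩ := ih fun q hq => hJ q (by omega)
    have hb' := run_b_mask_succ (hJ (2 * ℓ) (by omega)) x hu hb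
    refine ⟨?_, hb'⟩
    rw [run_u_succ, run_u_succ, hb']
    have hs := hJ (2 * ℓ + 1) (by omega)
    refine leastSquares_congr (fun i j hj => mask_apply_of_mem (hs hj) x i) (fun i j hj => ?_) _
    simp only [responses, mask_apply_of_mem (hs hj)]

lemma measurable_responses (i : Fin t) (j : Fin m) :
    Measurable fun x : Fin t → Fin m → Fin d → ℝ => responses w ustar bstar x i j := by
  unfold responses dotProduct; fun_prop

lemma measurable_hardThreshold (Δ : ℝ) :
    Measurable fun v : Fin d → ℝ => hardThreshold v Δ := by
  refine measurable_pi_iff.mpr fun s => ?_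
  unfold hardThreshold
  exact Measurable.ite (measurableSet_lt measurable_const (by fun_prop)) (by fun_prop)
    measurable_const

/-- The inverse is the adjugate divided by the determinant, both continuous in `x`; inversion on `ℝ`
is measurable even at singular matrices, where it takes the value 0. -/
lemma measurable_inv_gram (J : Finset (Fin m)) (s s' : Fin d) :
    Measurable fun x : Fin t → Fin m → Fin d → ℝ =>
      ((∑ i, ∑ j ∈ J, Matrix.vecMulVec (x i j) (x i j))⁻¹ : Matrix (Fin d) (Fin d) ℝ) s s' := by
  have hG : Continuous fun x : Fin t → Fin m → Fin d → ℝ =>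
      ∑ i, ∑ j ∈ J, Matrix.vecMulVec (x i j) (x i j) := by
    refine continuous_finsetSum _ fun i _ => continuous_finsetSum _ fun j _ => ?_
    exact Continuous.matrix_vecMulVec (by fun_prop) (by fun_prop)
  simp only [Matrix.inv_def, Ring.inverse_eq_inv', Matrix.smul_apply, smul_eq_mul]
  exact (hG.matrix_det.measurable.inv).mul (hG.matrix_adjugate.matrix_elem s s').measurable

lemma measurable_leastSquares {J : Finset (Fin m)}
    {B : (Fin t → Fin m → Fin d → ℝ) → Fin t → Fin d → ℝ} (hB : Measurable B) :
    Measurable fun x => leastSquares J x (responses w ustar bstar x) (B x) := by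
  have hr := measurable_responses (t := t) (m := m) (w := w) (ustar := ustar) (bstar := bstar)
  refine measurable_pi_iff.mpr fun s => ?_
  simp only [leastSquares, Matrix.mulVec, dotProduct, Finset.sum_apply, Pi.smul_apply,
    smul_eq_mul]
  refine Finset.measurable_sum _ fun s' _ => (measurable_inv_gram J s s').mul ?_
  refine Finset.measurable_sum _ fun i _ => Finset.measurable_sum _ fun j _ => ?_
  refine Measurable.mul ((hr i j).sub ?_) (by fun_prop)
  exact Finset.measurable_sum _ fun s'' _ => by fun_prop

lemma measurable_run (ℓ : ℕ) :
    Measurable (fun x : Fin t → Fin m → Fin d → ℝ =>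
        (run c₁ c₂ c₃ k L E₀ w ustar bstar x ℓ).u) ∧
      Measurable (fun x : Fin t → Fin m → Fin d → ℝ =>
        (run c₁ c₂ c₃ k L E₀ w ustar bstar x ℓ).b) := by
  induction ℓ with
  | zero => exact ⟨measurable_const, measurable_const⟩
  | succ ℓ ih =>
    obtain ⟨hu, hb⟩ := ih
    have hb' : Measurable (fun x : Fin t → Fin m → Fin d → ℝ =>
        (run c₁ c₂ c₃ k L E₀ w ustar bstar x (ℓ + 1)).b) := by
      refine measurable_pi_iff.mpr fun i => ?_
      simp only [run_b_succ]
      refine (measurable_hardThreshold _).comp ?_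
      refine measurable_pi_iff.mpr fun s => ?_
      have hr := measurable_responses (t := t) (m := m) (w := w) (ustar := ustar) (bstar := bstar)
      simp only [gradientStep, dotProduct, Pi.sub_apply, Pi.add_apply, Finset.sum_apply,
        Pi.smul_apply, smul_eq_mul]
      fun_prop
    refine ⟨?_, hb'⟩
    simp only [run_u_succ]
    exact measurable_leastSquares hb'

end algorithm

/-! ### Norm inequalities and sparse vectors. -/

section vectors

variable {d : ℕ}

lemma l2norm_le_iff {v : Fin d → ℝ} {r : ℝ} (hr : 0 ≤ r) : l2norm v ≤ r ↔ v ⬝ᵥ v ≤ r ^ 2 := by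
  rw [← l2norm_sq, sq_le_sq₀ (l2norm_nonneg v) hr]

lemma l2norm_add_le (v v' : Fin d → ℝ) : l2norm (v + v') ≤ l2norm v + l2norm v' :=
  norm_add_le _ _

lemma l2norm_sub_le (v v' : Fin d → ℝ) : l2norm (v - v') ≤ l2norm v + l2norm v' :=
  norm_sub_le _ _

lemma l2norm_smul (c : ℝ) (v : Fin d → ℝ) : l2norm (c • v) = |c| * l2norm v :=
  norm_smul c (WithLp.toLp 2 v)

lemma l2norm_sum_le {ι : Type*} (S : Finset ι) (f : ι → Fin d → ℝ) :
    l2norm (∑ i ∈ S, f i) ≤ ∑ i ∈ S, l2norm (f i) := by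
  unfold l2norm
  rw [WithLp.toLp_sum]
  exact norm_sum_le _ _

lemma abs_dotProduct_le (v v' : Fin d → ℝ) : |v ⬝ᵥ v'| ≤ l2norm v * l2norm v' := by
  have h := abs_real_inner_le_norm (WithLp.toLp 2 v') (WithLp.toLp 2 v)
  rw [EuclideanSpace.inner_eq_star_dotProduct] at h
  simpa [l2norm, mul_comm] using h

lemma abs_le_l2norm (v : Fin d → ℝ) (s : Fin d) : |v s| ≤ l2norm v :=
  PiLp.norm_apply_le (WithLp.toLp 2 v) s

lemma abs_apply_le_norm (v : Fin d → ℝ) (s : Fin d) : |v s| ≤ ‖v‖ := norm_le_pi_norm v s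

lemma norm_le_of_abs_le {v : Fin d → ℝ} {r : ℝ} (hr : 0 ≤ r) (h : ∀ s, |v s| ≤ r) : ‖v‖ ≤ r :=
  (pi_norm_le_iff_of_nonneg hr).mpr h

lemma l2norm_le_sqrt_mul {v : Fin d → ℝ} {r : ℝ} (hr : 0 ≤ r) (h : ∀ s, |v s| ≤ r) :
    l2norm v ≤ √d * r := by
  rw [l2norm_le_iff (by positivity), mul_pow, Real.sq_sqrt (by positivity)]
  calc v ⬝ᵥ v ≤ ∑ _s : Fin d, r ^ 2 :=
        Finset.sum_le_sum fun s _ => by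
          rw [← sq]; exact sq_le_sq' (abs_le.mp (h s)).1 (abs_le.mp (h s)).2
    _ = _ := by simp

lemma l2norm_le_of_sparse {v b : Fin d → ℝ} {r : ℝ} {k : ℕ} (hr : 0 ≤ r) (h : ∀ s, |v s| ≤ r)
    (hb : hammingNorm b ≤ k) (hv : ∀ s, b s = 0 → v s = 0) : l2norm v ≤ √k * r := by
  rw [l2norm_le_iff (by positivity), mul_pow, Real.sq_sqrt (by positivity)]
  have : v ⬝ᵥ v = ∑ s ∈ Finset.univ.filter (fun s => b s ≠ 0), v s * v s := by
    rw [dotProduct, Finset.sum_filter]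
    refine Finset.sum_congr rfl fun s _ => ?_
    split_ifs with hs
    · rfl
    · rw [hv s (not_not.mp hs), mul_zero]
  rw [this]
  calc _ ≤ ∑ _s ∈ Finset.univ.filter (fun s => b s ≠ 0), r ^ 2 :=
        Finset.sum_le_sum fun s _ => by
          rw [← sq]; exact sq_le_sq' (abs_le.mp (h s)).1 (abs_le.mp (h s)).2
    _ = (hammingNorm b : ℝ) * r ^ 2 := by simp [hammingNorm]
    _ ≤ _ := by gcongr

lemma abs_sum_le_of_sparse {t ζ : ℕ} {v b : Fin t → ℝ} {r : ℝ} (hr : 0 ≤ r) (h : ∀ i, |v i| ≤ r)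
    (hb : hammingNorm b ≤ ζ) (hv : ∀ i, b i = 0 → v i = 0) : |∑ i, v i| ≤ ζ * r := by
  have : ∑ i, v i = ∑ i ∈ Finset.univ.filter (fun i => b i ≠ 0), v i := by
    rw [Finset.sum_filter]
    refine Finset.sum_congr rfl fun i _ => ?_
    split_ifs with hi
    · rfl
    · exact hv i (not_not.mp hi)
  rw [this]
  calc _ ≤ ∑ i ∈ Finset.univ.filter (fun i => b i ≠ 0), |v i| := Finset.abs_sum_le_sum_abs _ _
    _ ≤ ∑ _i ∈ Finset.univ.filter (fun i => b i ≠ 0), r := Finset.sum_le_sum fun i _ => h i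
    _ = (hammingNorm b : ℝ) * r := by simp [hammingNorm]
    _ ≤ _ := by gcongr

end vectors

/-! ### Operator norms from a grid in the unit ball. -/

section net

variable {d : ℕ}

/-- The indices of the points of the cubic grid of mesh `1 / (4 * d)` in `[-1, 1]^d`. -/
def gridIndex (d : ℕ) : Finset (Fin d → ℤ) :=
  Fintype.piFinset fun _ => Finset.Icc (-(4 * d : ℤ)) (4 * d)

/-- The grid point with a given index. -/
def gridPoint (a : Fin d → ℤ) : Fin d → ℝ := fun s => a s / (4 * d)

lemma card_gridIndex : (gridIndex d).card = (8 * d + 1) ^ d := by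
  simp only [gridIndex, Fintype.card_piFinset, Int.card_Icc, Finset.prod_const, Finset.card_univ,
    Fintype.card_fin]
  congr 1
  omega

/-- Rounding is towards zero, so that the approximating grid point stays in the unit ball. -/
lemma exists_int_near {D : ℕ} (hD : 0 < D) {v : ℝ} (hv : |v| ≤ 1) :
    ∃ a ∈ Finset.Icc (-(D : ℤ)) D, |(a : ℝ) / D| ≤ |v| ∧ |v - a / D| ≤ 1 / D := by
  have hD' : (0 : ℝ) < D := by exact_mod_cast hD
  have key : ∀ v : ℝ, 0 ≤ v → v ≤ 1 → ∃ a ∈ Finset.Icc (-(D : ℤ)) D,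
      |(a : ℝ) / D| ≤ |v| ∧ |v - a / D| ≤ 1 / D := by
    intro v h0 h1
    have hf0 : 0 ≤ ⌊D * v⌋ := Int.floor_nonneg.mpr (by positivity)
    have hf1 : (⌊D * v⌋ : ℝ) ≤ D * v := Int.floor_le _
    have hf2 : D * v < ⌊D * v⌋ + 1 := Int.lt_floor_add_one _
    have hf0' : (0 : ℝ) ≤ ⌊D * v⌋ := by exact_mod_cast hf0
    have hle : (⌊D * v⌋ : ℝ) / D ≤ v := by rw [div_le_iff₀ hD']; linarith
    refine ⟨⌊D * v⌋, ?_, ?_, ?_⟩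
    · rw [Finset.mem_Icc]
      refine ⟨by omega, ?_⟩
      have : (⌊D * v⌋ : ℝ) ≤ (D : ℤ) := by push_cast; nlinarith
      exact_mod_cast this
    · rw [abs_of_nonneg (by positivity), abs_of_nonneg h0]; exact hle
    · rw [abs_of_nonneg (by linarith), sub_le_iff_le_add, ← add_div, le_div_iff₀ hD']
      linarith
  rcases le_total 0 v with h | h
  · exact key v h (abs_le.mp hv).2
  · obtain ⟨a, ha, h1, h2⟩ := key (-v) (by linarith) (by linarith [(abs_le.mp hv).1])
    refine ⟨-a, ?_, ?_, ?_⟩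
    · rw [Finset.mem_Icc] at ha ⊢; omega
    · push_cast; rw [neg_div, abs_neg]; rwa [abs_neg] at h1
    · push_cast
      rw [neg_div, ← abs_neg]
      convert h2 using 2
      ring

lemma exists_gridPoint_near (hd : 0 < d) {v : Fin d → ℝ} (hv : l2norm v ≤ 1) :
    ∃ a ∈ gridIndex d, l2norm (gridPoint a) ≤ 1 ∧ l2norm (v - gridPoint a) ≤ 1 / 4 := by
  have hd' : (1 : ℝ) ≤ d := by exact_mod_cast hd
  choose a ha h1 h2 using fun s => exists_int_near (D := 4 * d) (by omega)
    ((abs_le_l2norm v s).trans hv)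
  refine ⟨a, ?_, ?_, ?_⟩
  · rw [gridIndex, Fintype.mem_piFinset]
    intro s
    have := ha s
    push_cast at this
    exact this
  · rw [l2norm_le_iff zero_le_one]
    rw [l2norm_le_iff zero_le_one] at hv
    refine le_trans (Finset.sum_le_sum fun s _ => ?_) hv
    have := h1 s
    push_cast at this
    rw [← sq, ← sq]
    exact sq_le_sq.mpr this
  · refine (l2norm_le_sqrt_mul (r := 1 / (4 * d)) (by positivity) fun s => ?_).trans ?_
    · have := h2 s
      push_cast at this
      exact this
    · have : √(d : ℝ) ≤ d := Real.sqrt_le_iff.mpr ⟨by linarith, by nlinarith⟩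
      rw [mul_one_div, div_le_div_iff₀ (by positivity) (by norm_num)]
      linarith

/-- A matrix whose bilinear form is small on the grid points of the unit ball has small operator
norm. -/
lemma l2norm_mulVec_le_of_grid (hd : 0 < d) {M : Matrix (Fin d) (Fin d) ℝ} {θ : ℝ}
    (h : ∀ a ∈ gridIndex d, ∀ b ∈ gridIndex d, l2norm (gridPoint a) ≤ 1 →
      l2norm (gridPoint b) ≤ 1 → |gridPoint a ⬝ᵥ M *ᵥ gridPoint b| ≤ θ) (v : Fin d → ℝ) :
    l2norm (M *ᵥ v) ≤ 2 * θ * l2norm v := by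
  set T := Matrix.toEuclideanCLM (𝕜 := ℝ) (n := Fin d) M
  have hT : ∀ v : Fin d → ℝ, T (WithLp.toLp 2 v) = WithLp.toLp 2 (M *ᵥ v) := fun v =>
    Matrix.toEuclideanCLM_toLp M v
  have hle : ∀ v : Fin d → ℝ, l2norm (M *ᵥ v) ≤ ‖T‖ * l2norm v := by
    intro v
    have := T.le_opNorm (WithLp.toLp 2 v)
    rwa [hT] at this
  have hθ : 0 ≤ θ := by
    obtain ⟨a, ha, ha1, -⟩ := exists_gridPoint_near hd (v := 0) (by simp [l2norm])
    exact (abs_nonneg _).trans (h a ha a ha ha1 ha1)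
  have key : ∀ v : Fin d → ℝ, l2norm v ≤ 1 → l2norm (M *ᵥ v) ≤ θ + ‖T‖ / 2 := by
    intro v hv
    rcases (l2norm_nonneg (M *ᵥ v)).eq_or_lt with h0 | h0
    · rw [← h0]; positivity
    set u := (l2norm (M *ᵥ v))⁻¹ • (M *ᵥ v) with hu
    have hu1 : l2norm u ≤ 1 := by
      rw [hu, l2norm_smul, abs_of_pos (by positivity), inv_mul_cancel₀ h0.ne']
    have huM : u ⬝ᵥ M *ᵥ v = l2norm (M *ᵥ v) := by
      rw [hu, smul_dotProduct, ← l2norm_sq, smul_eq_mul]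
      field_simp
    obtain ⟨a, ha, ha1, ha2⟩ := exists_gridPoint_near hd hu1
    obtain ⟨b, hb, hb1, hb2⟩ := exists_gridPoint_near hd hv
    -- Each of the two corrections costs at most `‖T‖ / 4`; the resulting `‖T‖ ≤ θ + ‖T‖ / 2` gives
    -- `‖T‖ ≤ 2 * θ`.
    have hsplit : u ⬝ᵥ M *ᵥ v = gridPoint a ⬝ᵥ M *ᵥ gridPoint b +
        (u - gridPoint a) ⬝ᵥ M *ᵥ v + gridPoint a ⬝ᵥ M *ᵥ (v - gridPoint b) := by
      rw [Matrix.mulVec_sub, sub_dotProduct, dotProduct_sub]; ring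
    rw [← huM, hsplit]
    have e1 := (abs_le.mp (h a ha b hb ha1 hb1)).2
    have e2 : (u - gridPoint a) ⬝ᵥ M *ᵥ v ≤ 1 / 4 * (‖T‖ * 1) :=
      (le_abs_self _).trans ((abs_dotProduct_le _ _).trans (mul_le_mul ha2
        ((hle v).trans (by gcongr)) (l2norm_nonneg _) (by norm_num)))
    have e3 : gridPoint a ⬝ᵥ M *ᵥ (v - gridPoint b) ≤ 1 * (‖T‖ * (1 / 4)) :=
      (le_abs_self _).trans ((abs_dotProduct_le _ _).trans (mul_le_mul ha1
        ((hle _).trans (by gcongr)) (l2norm_nonneg _) (by norm_num)))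
    linarith
  have hTn : ‖T‖ ≤ θ + ‖T‖ / 2 := by
    refine ContinuousLinearMap.opNorm_le_of_unit_norm (by positivity) fun x hx => ?_
    have := key x.ofLp (by rw [l2norm]; exact hx.le)
    rwa [l2norm, ← hT] at this
  refine (hle v).trans ?_
  have := l2norm_nonneg v
  gcongr
  linarith

end net

/-! ### Deterministic error analysis of the two updates. -/

section updates

variable {t m d : ℕ}

lemma gradientStep_error {J : Finset (Fin m)} (hJ : 0 < J.card) {x : Fin m → Fin d → ℝ}
    {us bs u b : Fin d → ℝ} {κ : ℝ}
    (h : ∀ s, |∑ j ∈ J, (x j s * (x j ⬝ᵥ ((u - us) + (b - bs))) - ((u - us) + (b - bs)) s)| ≤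
      κ * J.card) (s : Fin d) :
    |gradientStep J x (fun j => x j ⬝ᵥ (us + bs)) u b s - bs s| ≤ ‖u - us‖ + κ := by
  have hn : (0 : ℝ) < J.card := by exact_mod_cast hJ
  have hid : gradientStep J x (fun j => x j ⬝ᵥ (us + bs)) u b s - bs s = -((u - us) s) -
      (J.card : ℝ)⁻¹ * ∑ j ∈ J, (x j s * (x j ⬝ᵥ ((u - us) + (b - bs))) -
        ((u - us) + (b - bs)) s) := by
    have he : ∀ j, x j ⬝ᵥ (u + b) - x j ⬝ᵥ (us + bs) = x j ⬝ᵥ ((u - us) + (b - bs)) := by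
      intro j
      rw [← dotProduct_sub]
      congr 1
      abel
    simp only [gradientStep, he, Pi.sub_apply, Pi.smul_apply, Finset.sum_apply, smul_eq_mul,
      Finset.sum_sub_distrib, Finset.sum_const, nsmul_eq_mul, Pi.add_apply]
    rw [mul_sub, inv_mul_cancel_left₀ hn.ne',
      Finset.sum_congr rfl fun j _ => mul_comm (x j ⬝ᵥ ((u - us) + (b - bs))) (x j s)]
    ring
  rw [hid]
  refine (abs_sub _ _).trans (add_le_add ?_ ?_)
  · rw [abs_neg]; exact abs_apply_le_norm _ _
  · rw [abs_mul, abs_of_pos (by positivity), inv_mul_le_iff₀ hn, mul_comm]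
    exact h s

/-- Off the support of `b` the entry of `v` is itself an error, hence at most `Δ` and removed.
Elsewhere thresholding moves an entry by at most a further `Δ`. -/
lemma hardThreshold_error {v b : Fin d → ℝ} {Δ : ℝ} (h : ∀ s, |v s - b s| ≤ Δ) (s : Fin d) :
    (b s = 0 → hardThreshold v Δ s = 0) ∧ |hardThreshold v Δ s - b s| ≤ 2 * Δ := by
  have hs := h s
  have h0 : 0 ≤ Δ := (abs_nonneg _).trans hs
  unfold hardThreshold
  split_ifs with hΔ
  · refine ⟨fun hb => ?_, by linarith⟩
    rw [hb, sub_zero] at hs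
    exact absurd hs (not_le.mpr hΔ)
  · refine ⟨fun _ => rfl, ?_⟩
    rw [abs_le] at hs ⊢
    have := abs_le.mp (not_lt.mp hΔ)
    constructor <;> linarith

lemma dotProduct_gram_mulVec (J : Finset (Fin m)) (x : Fin t → Fin m → Fin d → ℝ)
    (p q : Fin d → ℝ) :
    p ⬝ᵥ (∑ i, ∑ j ∈ J, Matrix.vecMulVec (x i j) (x i j)) *ᵥ q =
      ∑ i, ∑ j ∈ J, (x i j ⬝ᵥ p) * (x i j ⬝ᵥ q) := by
  simp only [Matrix.sum_mulVec, dotProduct_sum, Matrix.vecMulVec_mulVec]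
  refine Finset.sum_congr rfl fun i _ => Finset.sum_congr rfl fun j _ => ?_
  simp [dotProduct_comm p, mul_comm]

lemma gram_mulVec (J : Finset (Fin m)) (x : Fin t → Fin m → Fin d → ℝ) (q : Fin d → ℝ) :
    (∑ i, ∑ j ∈ J, Matrix.vecMulVec (x i j) (x i j)) *ᵥ q =
      ∑ i, ∑ j ∈ J, (x i j ⬝ᵥ q) • x i j := by
  simp only [Matrix.sum_mulVec, Matrix.vecMulVec_mulVec]
  refine Finset.sum_congr rfl fun i _ => Finset.sum_congr rfl fun j _ => ?_
  simp

/-- The error `z` satisfies `z = g - M z` with `g` small in every entry. Since `η ≤ 1/2`, absorbing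
`M z` gives the Euclidean bound; inserting this bound into the same identity gives the entrywise
one, without the loss of `√d` on the leading term `σ`. -/
lemma leastSquares_error {J : Finset (Fin m)} {x : Fin t → Fin m → Fin d → ℝ}
    {us f : Fin d → ℝ} {b bs : Fin t → Fin d → ℝ} {N η σ : ℝ} (hN : 0 < N) (hη : η ≤ 1 / 2)
    (hσ : 0 ≤ σ)
    (hM : ∀ v : Fin d → ℝ, l2norm ((N⁻¹ • (∑ i, ∑ j ∈ J, Matrix.vecMulVec (x i j) (x i j)) -
      (1 : Matrix (Fin d) (Fin d) ℝ)) *ᵥ v) ≤ η * l2norm v)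
    (hg : ∀ s, |∑ i, ∑ j ∈ J, x i j s * (x i j ⬝ᵥ (bs i - b i - f))| ≤ N * σ) :
    l2norm (leastSquares J x (fun i j => x i j ⬝ᵥ (us + bs i)) b - us - f) ≤ 2 * (√d * σ) ∧
      ∀ s, |(leastSquares J x (fun i j => x i j ⬝ᵥ (us + bs i)) b - us - f) s| ≤
        σ + |η| * (2 * (√d * σ)) := by
  set G : Matrix (Fin d) (Fin d) ℝ := ∑ i, ∑ j ∈ J, Matrix.vecMulVec (x i j) (x i j) with hG
  set U := leastSquares J x (fun i j => x i j ⬝ᵥ (us + bs i)) b with hU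
  set z := U - us - f with hz
  have hMv : ∀ v, (N⁻¹ • G - 1) *ᵥ v = N⁻¹ • (G *ᵥ v) - v := fun v => by
    rw [Matrix.sub_mulVec, Matrix.smul_mulVec, Matrix.one_mulVec]
  have hunit : IsUnit G := by
    rw [← Matrix.mulVec_injective_iff_isUnit]
    intro v v' hvv
    have h0 : G *ᵥ (v - v') = 0 := by rw [Matrix.mulVec_sub]; exact sub_eq_zero.mpr hvv
    have h1 := hM (v - v')
    rw [hMv, h0, smul_zero, zero_sub] at h1
    have h2 : l2norm (-(v - v')) = l2norm (v - v') := norm_neg _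
    rw [h2] at h1
    have h3 := l2norm_nonneg (v - v')
    have h4 : l2norm (v - v') = 0 := by nlinarith
    have h5 : (v - v') ⬝ᵥ (v - v') = 0 := by rw [← l2norm_sq, h4]; norm_num
    exact sub_eq_zero.mp (dotProduct_self_eq_zero.mp h5)
  have hGU : G *ᵥ U = ∑ i, ∑ j ∈ J, (x i j ⬝ᵥ (us + bs i) - x i j ⬝ᵥ b i) • x i j := by
    rw [hU, leastSquares, Matrix.mulVec_mulVec,
      Matrix.mul_nonsing_inv _ ((Matrix.isUnit_iff_isUnit_det _).mp hunit), Matrix.one_mulVec]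
  have hGz : G *ᵥ z = ∑ i, ∑ j ∈ J, (x i j ⬝ᵥ (bs i - b i - f)) • x i j := by
    rw [hz, Matrix.mulVec_sub, Matrix.mulVec_sub, hGU, hG, gram_mulVec, gram_mulVec,
      ← Finset.sum_sub_distrib, ← Finset.sum_sub_distrib]
    refine Finset.sum_congr rfl fun i _ => ?_
    rw [← Finset.sum_sub_distrib, ← Finset.sum_sub_distrib]
    refine Finset.sum_congr rfl fun j _ => ?_
    rw [← sub_smul, ← sub_smul, ← dotProduct_sub, ← dotProduct_sub, ← dotProduct_sub]
    congr 2
    abel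
  set g := N⁻¹ • (G *ᵥ z) with hgd
  have hgs : ∀ s, |g s| ≤ σ := by
    intro s
    rw [hgd, hGz, Pi.smul_apply, smul_eq_mul, abs_mul, abs_of_pos (by positivity),
      inv_mul_le_iff₀ hN]
    refine le_trans (le_of_eq ?_) (hg s)
    simp only [Finset.sum_apply, Pi.smul_apply, smul_eq_mul, mul_comm]
  have hzg : z = g - (N⁻¹ • G - 1) *ᵥ z := by rw [hMv]; abel
  have hg2 := l2norm_le_sqrt_mul hσ hgs
  have hMz := hM z
  have hz0 := l2norm_nonneg z
  have hz2 : l2norm z ≤ 2 * (√d * σ) := by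
    have h1 : l2norm z ≤ l2norm g + l2norm ((N⁻¹ • G - 1) *ᵥ z) := by
      conv_lhs => rw [hzg]
      exact l2norm_sub_le _ _
    nlinarith
  refine ⟨hz2, fun s => ?_⟩
  have h1 : z s = g s - ((N⁻¹ • G - 1) *ᵥ z) s := by
    conv_lhs => rw [hzg]
    rfl
  rw [h1]
  refine (abs_sub _ _).trans (add_le_add (hgs s) ?_)
  refine (abs_le_l2norm _ _).trans (hMz.trans ?_)
  have := le_abs_self η
  have := abs_nonneg η
  gcongr

end updates

/-! ### Sizes and disjointness of the batches. -/

section batches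

variable {m L : ℕ}

lemma card_batch {q : ℕ} (hq : q < 2 * L) : (batch m L q).card = m / (2 * L) := by
  have hle : (q + 1) * (m / (2 * L)) ≤ m :=
    (Nat.mul_le_mul_right _ (by omega)).trans (Nat.mul_div_le m (2 * L))
  have : (batch m L q).map Fin.valEmbedding =
      Finset.Ico (q * (m / (2 * L))) ((q + 1) * (m / (2 * L))) := by
    ext j
    simp only [batch, Finset.mem_map, Finset.mem_filter, Finset.mem_univ, true_and,
      Fin.valEmbedding_apply, Finset.mem_Ico]
    constructor
    · rintro ⟨a, ha, rfl⟩; exact ha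
    · intro hj; exact ⟨⟨j, by omega⟩, hj, rfl⟩
  rw [← Finset.card_map, this, Nat.card_Ico, Nat.add_mul, one_mul, Nat.add_sub_cancel_left]

/-- The indices of the samples in the batches before the `q`-th. -/
def batchesBefore (m L q : ℕ) : Finset (Fin m) :=
  Finset.univ.filter fun j => (j : ℕ) < q * (m / (2 * L))

lemma disjoint_batchesBefore (q : ℕ) : Disjoint (batchesBefore m L q) (batch m L q) := by
  rw [Finset.disjoint_left]
  intro j h1 h2
  simp only [batchesBefore, batch, Finset.mem_filter] at h1 h2
  omega

lemma batch_subset_batchesBefore {q q' : ℕ} (h : q' < q) :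
    batch m L q' ⊆ batchesBefore m L q := by
  intro j hj
  simp only [batchesBefore, batch, Finset.mem_filter] at hj ⊢
  exact ⟨hj.1, hj.2.2.trans_le (Nat.mul_le_mul_right _ h)⟩

end batches

/-! ### Error bounds for one iteration. -/

variable {t m d : ℕ}

/-- Deviations of the bilinear form of a fixed vector and vectors computed from other samples. -/
lemma fresh_bilinear_tail {J J' : Finset (Fin m)} (hJ : Disjoint J J') (T : Finset (Fin t))
    {p : Fin d → ℝ} (hp : l2norm p ≤ 1) {Q : (Fin t → Fin m → Fin d → ℝ) → Fin t → Fin d → ℝ}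
    (hQm : Measurable Q) (hQ : ∀ x, Q (mask J x) = Q x) {ρ θ : ℝ} (hρ : 0 ≤ ρ) (h0 : 0 ≤ θ)
    (h1 : θ ≤ 1) :
    (covariateLaw t m d).real {x | (∀ i ∈ T, l2norm (Q x i) ≤ ρ) ∧
      θ * ρ * (T.card * J'.card) <
        |∑ i ∈ T, ∑ j ∈ J', ((x i j ⬝ᵥ p) * (x i j ⬝ᵥ Q x i) - p ⬝ᵥ Q x i)|} ≤
      4 * Real.exp (-(θ ^ 2 * (T.card * J'.card) / 32)) := by
  set B : Set ((Fin t → Fin m → Fin d → ℝ) × (Fin t → Fin m → Fin d → ℝ)) :=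
    {z | (∀ i ∈ T, Q z.1 i ⬝ᵥ Q z.1 i ≤ ρ ^ 2) ∧ θ * ρ * (T.card * J'.card) <
        |∑ i ∈ T, ∑ j ∈ J', ((z.2 i j ⬝ᵥ p) * (z.2 i j ⬝ᵥ Q z.1 i) - p ⬝ᵥ Q z.1 i)|} with hBdef
  have hdot : ∀ f g : ((Fin t → Fin m → Fin d → ℝ) × (Fin t → Fin m → Fin d → ℝ)) → Fin d → ℝ,
      Measurable f → Measurable g → Measurable fun z => f z ⬝ᵥ g z := by
    intro f g hf hg
    unfold dotProduct
    fun_prop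
  have hB1 : MeasurableSet {z : (Fin t → Fin m → Fin d → ℝ) × (Fin t → Fin m → Fin d → ℝ) |
      ∀ i ∈ T, Q z.1 i ⬝ᵥ Q z.1 i ≤ ρ ^ 2} := by
    have : {z : (Fin t → Fin m → Fin d → ℝ) × (Fin t → Fin m → Fin d → ℝ) |
        ∀ i ∈ T, Q z.1 i ⬝ᵥ Q z.1 i ≤ ρ ^ 2} = ⋂ i ∈ T, {z | Q z.1 i ⬝ᵥ Q z.1 i ≤ ρ ^ 2} := by
      ext z; simp
    rw [this]
    exact Finset.measurableSet_biInter T fun i _ =>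
      measurableSet_le (hdot _ _ (by fun_prop) (by fun_prop)) measurable_const
  have hB2 : MeasurableSet {z : (Fin t → Fin m → Fin d → ℝ) × (Fin t → Fin m → Fin d → ℝ) |
      θ * ρ * (T.card * J'.card) <
        |∑ i ∈ T, ∑ j ∈ J', ((z.2 i j ⬝ᵥ p) * (z.2 i j ⬝ᵥ Q z.1 i) - p ⬝ᵥ Q z.1 i)|} := by
    refine measurableSet_lt measurable_const (Measurable.abs ?_)
    refine Finset.measurable_sum _ fun i _ => Finset.measurable_sum _ fun j _ => ?_
    exact ((hdot _ _ (by fun_prop) (by fun_prop)).mul (hdot _ _ (by fun_prop) (by fun_prop))).sub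
      (hdot _ _ (by fun_prop) (by fun_prop))
  have hB : MeasurableSet B := hB1.inter hB2
  have hdep : ∀ x y, (x, y) ∈ B ↔ (mask J x, mask J' y) ∈ B := by
    intro x y
    have hs : ∑ i ∈ T, ∑ j ∈ J', ((mask J' y i j ⬝ᵥ p) * (mask J' y i j ⬝ᵥ Q x i) - p ⬝ᵥ Q x i) =
        ∑ i ∈ T, ∑ j ∈ J', ((y i j ⬝ᵥ p) * (y i j ⬝ᵥ Q x i) - p ⬝ᵥ Q x i) :=
      Finset.sum_congr rfl fun i _ => Finset.sum_congr rfl fun j hj => by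
        rw [mask_apply_of_mem hj]
    simp only [hBdef, Set.mem_ofPred_eq, hQ, hs]
  have hset : {x | (∀ i ∈ T, l2norm (Q x i) ≤ ρ) ∧ θ * ρ * (T.card * J'.card) <
        |∑ i ∈ T, ∑ j ∈ J', ((x i j ⬝ᵥ p) * (x i j ⬝ᵥ Q x i) - p ⬝ᵥ Q x i)|} =
      {x | (x, x) ∈ B} := by
    ext x
    simp only [hBdef, Set.mem_ofPred_eq, l2norm_le_iff hρ]
  rw [hset]
  refine measure_le_of_fresh hJ hB hdep (by positivity) fun y => ?_
  by_cases hy : ∀ i ∈ T, Q y i ⬝ᵥ Q y i ≤ ρ ^ 2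
  · have h := bilinear_tail (iIndepFun_covariates (t := t) (m := m) (d := d))
      (fun a => by fun_prop) map_covariate (T ×ˢ J') (fun _ => p) (fun a => Q y a.1) hρ
      (fun _ _ => by rw [l2norm_le_iff zero_le_one] at hp; simpa using hp)
      (fun a ha => hy a.1 (Finset.mem_product.mp ha).1) h0 h1
    simp only [Finset.card_product, Nat.cast_mul, Finset.sum_product] at h
    refine le_trans (measureReal_mono fun x hx => ?_) h
    exact hx.2
  · have : {x | (y, x) ∈ B} = ∅ := Set.eq_empty_of_forall_notMem fun x hx => hy hx.1
    rw [this]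
    simp
    positivity

/-- The two roots are the deviation levels `θ` for which the tail exponent `θ² N / 32` equals `5 d
lam`, enough for a union over pairs of grid points, and `lam`, enough for a union over coordinates.
The last bound is the one that needs `N` of order `d √k lam`. -/
lemma tail_parameter_bounds {lam N : ℝ} {k : ℕ} (hlam : 1 ≤ lam) (hk : 0 < k) (hd : 0 < d)
    (hN1 : 2 ^ 20 * k * lam ≤ N) (hN2 : 2 ^ 20 * (d * √(k : ℝ)) * lam ≤ N) :
    √(160 * d * lam / N) ≤ 1 / 4 ∧ √(32 * lam / N) * √(k : ℝ) ≤ 1 / 128 ∧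
      √(d : ℝ) * √(32 * lam / N) ≤ 1 / 4 ∧
      √(160 * d * lam / N) * √(32 * lam / N) * (√(d : ℝ) * √(k : ℝ)) ≤ 1 / 1024 := by
  have hk' : (1 : ℝ) ≤ k := by exact_mod_cast hk
  have hd' : (1 : ℝ) ≤ d := by exact_mod_cast hd
  have hsk : 1 ≤ √(k : ℝ) := Real.one_le_sqrt.mpr hk'
  have hN3 : 2 ^ 20 * d * lam ≤ N := by
    refine le_trans ?_ hN2
    gcongr
    nlinarith
  have hN : 0 < N := lt_of_lt_of_le (by positivity) hN1
  refine ⟨?_, ?_, ?_, ?_⟩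
  · rw [Real.sqrt_le_left (by norm_num), div_le_iff₀ hN]
    nlinarith
  · rw [← Real.sqrt_mul (by positivity), Real.sqrt_le_left (by norm_num), div_mul_eq_mul_div,
      div_le_iff₀ hN]
    nlinarith
  · rw [← Real.sqrt_mul (by positivity), Real.sqrt_le_left (by norm_num), mul_div_assoc',
      div_le_iff₀ hN]
    nlinarith
  · rw [← Real.sqrt_mul (by positivity), ← Real.sqrt_mul (by positivity),
      ← Real.sqrt_mul (by positivity), Real.sqrt_le_left (by norm_num)]
    have h1 : (2 ^ 20 * (d * √(k : ℝ)) * lam) ^ 2 ≤ N ^ 2 := by gcongr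
    have h2 : (2 ^ 20 * (d * √(k : ℝ)) * lam) ^ 2 = 2 ^ 40 * (d ^ 2 * k * lam ^ 2) := by
      rw [mul_pow, mul_pow, mul_pow, Real.sq_sqrt (by positivity)]; ring
    have h3 : 160 * d * lam / N * (32 * lam / N) * (d * k) =
        5120 * (d ^ 2 * k * lam ^ 2) / N ^ 2 := by
      field_simp; ring
    rw [h3, div_le_iff₀ (by positivity)]
    rw [h2] at h1
    nlinarith [show 0 ≤ d ^ 2 * k * lam ^ 2 by positivity]

lemma ErrorBounds.Valid.nonneg {E : ErrorBounds} {u us : Fin d → ℝ} {b bs : Fin t → Fin d → ℝ}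
    (h : E.Valid u b us bs) (ht : 0 < t) : 0 ≤ E.α ∧ 0 ≤ E.γ ∧ 0 ≤ E.β ∧ 0 ≤ E.τ :=
  ⟨(l2norm_nonneg _).trans (h.1 ⟨0, ht⟩), (norm_nonneg _).trans (h.2.1 ⟨0, ht⟩),
    (norm_nonneg _).trans h.2.2.1, (l2norm_nonneg _).trans h.2.2.2⟩

lemma gradient_update_error {E : ErrorBounds} {u us : Fin d → ℝ} {b bs : Fin t → Fin d → ℝ}
    {J : Finset (Fin m)} (hJ : 0 < J.card) {k : ℕ} (hk : 0 < k) {c₁ : ℝ} (hc₁ : 0 ≤ c₁)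
    {x : Fin t → Fin m → Fin d → ℝ}
    (hE : E.Valid u b us bs) (hα : E.α ≤ √(k : ℝ) * E.γ)
    (hA : ∀ i s, l2norm ((u - us) + (b i - bs i)) ≤ E.τ + E.α →
      |∑ j ∈ J, (x i j s * (x i j ⬝ᵥ ((u - us) + (b i - bs i))) -
        ((u - us) + (b i - bs i)) s)| ≤ c₁ / √(k : ℝ) * (E.τ + E.α) * J.card)
    (i : Fin t) (s : Fin d) :
    (bs i s = 0 → hardThreshold (gradientStep J (x i) (fun j => x i j ⬝ᵥ (us + bs i)) u (b i))
      (E.threshold c₁ k) s = 0) ∧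
    |hardThreshold (gradientStep J (x i) (fun j => x i j ⬝ᵥ (us + bs i)) u (b i))
      (E.threshold c₁ k) s - bs i s| ≤ E.nextGamma c₁ k := by
  have hsk : 0 < √(k : ℝ) := by positivity
  obtain ⟨h1, h2, h3, h4⟩ := hE
  have he : l2norm ((u - us) + (b i - bs i)) ≤ E.τ + E.α :=
    (l2norm_add_le _ _).trans (add_le_add h4 (h1 i))
  have hg : ∀ s, |gradientStep J (x i) (fun j => x i j ⬝ᵥ (us + bs i)) u (b i) s - bs i s| ≤
      E.threshold c₁ k := fun s =>
    (gradientStep_error hJ (fun s => hA i s he) s).trans (add_le_add h3 le_rfl)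
  obtain ⟨h5, h6⟩ := hardThreshold_error hg s
  refine ⟨h5, h6.trans ?_⟩
  have h7 : c₁ / √(k : ℝ) * E.α ≤ c₁ * E.γ := by
    rw [div_mul_eq_mul_div, div_le_iff₀ hsk]
    nlinarith
  have h8 : 2 * c₁ / √(k : ℝ) * E.τ = 2 * (c₁ / √(k : ℝ) * E.τ) := by ring
  rw [ErrorBounds.threshold, ErrorBounds.nextGamma, h8]
  linarith

/-- The average over the tasks. -/
def taskMean (f : Fin t → Fin d → ℝ) : Fin d → ℝ := (t : ℝ)⁻¹ • ∑ i, f i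

lemma l2norm_taskMean_le (ht : 0 < t) {f : Fin t → Fin d → ℝ} {r : ℝ}
    (h : ∀ i, l2norm (f i) ≤ r) : l2norm (taskMean f) ≤ r := by
  have ht' : (0 : ℝ) < t := by exact_mod_cast ht
  rw [taskMean, l2norm_smul, abs_of_pos (by positivity), inv_mul_le_iff₀ ht']
  refine (l2norm_sum_le _ _).trans ((Finset.sum_le_sum fun i _ => h i).trans ?_)
  simp

/-- Makes the expectation of the cross term in the least squares update vanish, so that
concentration alone bounds it. -/
lemma sum_sub_taskMean (ht : 0 < t) (f : Fin t → Fin d → ℝ) (s : Fin d) :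
    ∑ i, (f i - taskMean f) s = 0 := by
  have ht' : (0 : ℝ) < t := by exact_mod_cast ht
  simp only [taskMean, Pi.sub_apply, Pi.smul_apply, Finset.sum_apply, Finset.sum_sub_distrib,
    Finset.sum_const, Finset.card_univ, Fintype.card_fin, nsmul_eq_mul, smul_eq_mul]
  field_simp
  ring

lemma leastSquares_update_error (ht : 0 < t) (hd : 0 < d) {k ζ : ℕ} (hk : 0 < k)
    {us : Fin d → ℝ} {b bs : Fin t → Fin d → ℝ} (hsparse : RowColSparse bs ζ k)
    (hζ : (ζ : ℝ) ≤ 1 / 32 * t) {J : Finset (Fin m)} {x : Fin t → Fin m → Fin d → ℝ}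
    {γ lam : ℝ} (hγ : 0 ≤ γ) (hlam : 1 ≤ lam)
    (hN1 : 2 ^ 20 * k * lam ≤ t * J.card) (hN2 : 2 ^ 20 * (d * √(k : ℝ)) * lam ≤ t * J.card)
    (hb : ∀ i s, (bs i s = 0 → b i s = 0) ∧ |b i s - bs i s| ≤ γ)
    (hgrid : ∀ a ∈ gridIndex d, ∀ a' ∈ gridIndex d, l2norm (gridPoint a) ≤ 1 →
      l2norm (gridPoint a') ≤ 1 →
      |∑ i, ∑ j ∈ J, ((x i j ⬝ᵥ gridPoint a) * (x i j ⬝ᵥ gridPoint a') -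
        gridPoint a ⬝ᵥ gridPoint a')| ≤ √(160 * d * lam / (t * J.card)) * (t * J.card))
    (hcross : ∀ s, (∀ i, l2norm (bs i - b i - taskMean fun i => bs i - b i) ≤ 2 * √(k : ℝ) * γ) →
      |∑ i, ∑ j ∈ J, (x i j s * (x i j ⬝ᵥ (bs i - b i - taskMean fun i => bs i - b i)) -
        (bs i - b i - taskMean fun i => bs i - b i) s)| ≤
      √(32 * lam / (t * J.card)) * (2 * √(k : ℝ) * γ) * (t * J.card)) :
    ‖leastSquares J x (fun i j => x i j ⬝ᵥ (us + bs i)) b - us‖ ≤ 1 / 16 * γ ∧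
      l2norm (leastSquares J x (fun i j => x i j ⬝ᵥ (us + bs i)) b - us) ≤
        2 * √(k : ℝ) * γ := by
  have ht' : (0 : ℝ) < t := by exact_mod_cast ht
  have hk' : (0 : ℝ) < k := by exact_mod_cast hk
  set N : ℝ := t * J.card with hN
  have hNpos : 0 < N := lt_of_lt_of_le (by positivity) hN1
  obtain ⟨p1, p2, p3, p4⟩ := tail_parameter_bounds hlam hk hd hN1 hN2
  set θb := √(160 * d * lam / N)
  set θc := √(32 * lam / N)
  have hθb : 0 ≤ θb := Real.sqrt_nonneg _
  have hθc : 0 ≤ θc := Real.sqrt_nonneg _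
  set f : Fin t → Fin d → ℝ := fun i => bs i - b i with hf
  have hf0 : ∀ i s, bs i s = 0 → f i s = 0 := fun i s h => by simp [hf, h, (hb i s).1 h]
  have hfγ : ∀ i s, |f i s| ≤ γ := fun i s => by
    change |bs i s - b i s| ≤ γ
    rw [abs_sub_comm]
    exact (hb i s).2
  have hfl : ∀ i, l2norm (f i) ≤ √(k : ℝ) * γ := fun i =>
    l2norm_le_of_sparse hγ (hfγ i) (hsparse.2 i) (hf0 i)
  have hml := l2norm_taskMean_le ht hfl
  -- Row sparsity: at most `ζ ≤ t / 32` tasks contribute to an entry. This is half of the final `1 /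
  -- 16 * γ`; `q2` supplies the other half.
  have hms : ∀ s, |taskMean f s| ≤ 1 / 32 * γ := by
    intro s
    rw [taskMean, Pi.smul_apply, Finset.sum_apply, smul_eq_mul, abs_mul,
      abs_of_pos (by positivity), inv_mul_le_iff₀ ht']
    refine (abs_sum_le_of_sparse hγ (fun i => hfγ i s) (hsparse.1 s) (fun i => hf0 i s)).trans ?_
    nlinarith
  have hhl : ∀ i, l2norm (f i - taskMean f) ≤ 2 * √(k : ℝ) * γ := fun i =>
    (l2norm_sub_le _ _).trans (by linarith [hfl i])
  set σ := θc * (2 * √(k : ℝ) * γ) with hσ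
  have hσ0 : 0 ≤ σ := by positivity
  have hM := l2norm_mulVec_le_of_grid hd
    (M := N⁻¹ • (∑ i, ∑ j ∈ J, Matrix.vecMulVec (x i j) (x i j)) - 1) (θ := θb) (by
      intro a ha a' ha' h1 h1'
      rw [Matrix.sub_mulVec, Matrix.smul_mulVec, Matrix.one_mulVec, dotProduct_sub,
        dotProduct_smul, dotProduct_gram_mulVec, smul_eq_mul]
      have h := hgrid a ha a' ha' h1 h1'
      simp only [Finset.sum_sub_distrib, Finset.sum_const, Finset.card_univ, Fintype.card_fin,
        nsmul_eq_mul] at h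
      have hid : ∀ A B : ℝ, N⁻¹ * A - B = N⁻¹ * (A - t * (J.card * B)) := by
        intro A B
        rw [← mul_assoc, ← hN]
        field_simp
      rw [hid, abs_mul, abs_of_pos (by positivity), inv_mul_le_iff₀ hNpos, mul_comm N]
      exact h)
  have hg : ∀ s, |∑ i, ∑ j ∈ J, x i j s * (x i j ⬝ᵥ (bs i - b i - taskMean f))| ≤ N * σ := by
    intro s
    have h := hcross s hhl
    simp only [Finset.sum_sub_distrib, Finset.sum_const, nsmul_eq_mul, ← Finset.mul_sum] at h
    rw [sum_sub_taskMean ht f s, mul_zero, sub_zero, mul_comm _ N] at h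
    exact h
  obtain ⟨r1, r2⟩ := leastSquares_error (us := us) hNpos (by linarith) hσ0 hM hg
  have q1 : 2 * (√(d : ℝ) * σ) ≤ √(k : ℝ) * γ := by
    have : 2 * (√(d : ℝ) * σ) = 4 * (√(d : ℝ) * θc) * (√(k : ℝ) * γ) := by rw [hσ]; ring
    rw [this]
    have : 0 ≤ √(k : ℝ) * γ := by positivity
    nlinarith
  have q2 : σ + |2 * θb| * (2 * (√(d : ℝ) * σ)) ≤ 1 / 32 * γ := by
    have e1 : σ = 2 * (θc * √(k : ℝ)) * γ := by rw [hσ]; ring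
    have e2 : |2 * θb| * (2 * (√(d : ℝ) * σ)) = 8 * (θb * θc * (√(d : ℝ) * √(k : ℝ))) * γ := by
      rw [abs_of_nonneg (by positivity), hσ]; ring
    rw [e2, e1]
    nlinarith
  constructor
  · refine norm_le_of_abs_le (by positivity) fun s => ?_
    have h1 := (r2 s).trans q2
    have h2 := hms s
    rw [Pi.sub_apply _ (taskMean f)] at h1
    rw [abs_le] at h1 h2 ⊢
    constructor <;> linarith [h1.1, h1.2, h2.1, h2.2]
  · have h1 := l2norm_add_le (leastSquares J x (fun i j => x i j ⬝ᵥ (us + bs i)) b - us -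
      taskMean f) (taskMean f)
    rw [sub_add_cancel] at h1
    linarith

lemma l2norm_single_one (s : Fin d) : l2norm (Pi.single s 1 : Fin d → ℝ) ≤ 1 := by
  rw [l2norm_le_iff zero_le_one]; simp

/-! ### Union bound over the bad events of one iteration. -/

/-- The summands belong to gradient coordinates, pairs of grid points and cross-term coordinates. As
`8 d + 1 ≤ (3 d)² ≤ exp (2 lam)`, the grid term is at most `4 exp (-lam)`. So the total is at most
`4 (t d + 1 + d) exp (-lam) ≤ 12 t d exp (-lam)`; the 3 in the logarithm pays for this and for `1 ≤
lam`. -/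
lemma union_budget {L : ℕ} (ht : 0 < t) (hd : 0 < d) (hL : 0 < L) {δ lam : ℝ} (hδ : 0 < δ)
    (hδ1 : δ < 1) (hlam : lam = Real.log (3 * t * d * L / δ)) :
    1 ≤ lam ∧ (t * d : ℝ) * (4 * Real.exp (-lam)) +
      ((8 * d + 1 : ℝ) ^ d * (8 * d + 1 : ℝ) ^ d) * (4 * Real.exp (-(5 * d * lam))) +
      d * (4 * Real.exp (-lam)) ≤ 4 * δ / L := by
  have ht' : (1 : ℝ) ≤ t := by exact_mod_cast ht
  have hd' : (1 : ℝ) ≤ d := by exact_mod_cast hd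
  have hL' : (1 : ℝ) ≤ L := by exact_mod_cast hL
  have htd : (d : ℝ) ≤ t * d := by nlinarith
  have htdL : (d : ℝ) ≤ t * d * L := by nlinarith
  have hpos : 0 < 3 * t * d * L / δ := by positivity
  have he : Real.exp lam = 3 * t * d * L / δ := by rw [hlam, Real.exp_log hpos]
  have hge : 3 * (d : ℝ) ≤ Real.exp lam := by
    rw [he, le_div_iff₀ hδ]
    nlinarith
  have hlam1 : 1 ≤ lam := by
    rw [← Real.exp_le_exp]
    linarith [Real.exp_one_lt_d9]
  refine ⟨hlam1, ?_⟩
  have hgrid : ((8 * d + 1 : ℝ) ^ d * (8 * d + 1 : ℝ) ^ d) ≤ Real.exp (4 * d * lam) := by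
    have h1 : (8 * d + 1 : ℝ) ≤ Real.exp lam ^ 2 := by nlinarith
    calc ((8 * d + 1 : ℝ) ^ d * (8 * d + 1 : ℝ) ^ d)
        ≤ (Real.exp lam ^ 2) ^ d * (Real.exp lam ^ 2) ^ d := by gcongr
      _ = Real.exp (4 * d * lam) := by
        rw [← pow_mul, ← pow_add, ← Real.exp_nat_mul]
        congr 1
        push_cast
        ring
  have hg2 : ((8 * d + 1 : ℝ) ^ d * (8 * d + 1 : ℝ) ^ d) * (4 * Real.exp (-(5 * d * lam))) ≤
      4 * Real.exp (-lam) := by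
    calc _ ≤ Real.exp (4 * d * lam) * (4 * Real.exp (-(5 * d * lam))) := by gcongr
      _ = 4 * Real.exp (-(d * lam)) := by
        rw [mul_left_comm, ← Real.exp_add]
        congr 2
        ring
      _ ≤ _ := by
        gcongr
        nlinarith
  have hen : Real.exp (-lam) = δ / (3 * t * d * L) := by
    rw [Real.exp_neg, he, inv_div]
  have hep := Real.exp_pos (-lam)
  have hfin : 4 * δ / L = 12 * (t * d) * Real.exp (-lam) := by
    rw [hen]; field_simp; norm_num
  rw [hfin]
  nlinarith

/-- One iteration preserves the validity of the error bounds, up to an event of small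
probability. -/
lemma exists_bad_event {k ζ L ℓ : ℕ} (hℓ : ℓ < L) (ht : 0 < t) (hd : 0 < d) (hk : 0 < k)
    (w : ℝ) (ustar : Fin d → ℝ) {bstar : Fin t → Fin d → ℝ} (hsparse : RowColSparse bstar ζ k)
    (hζ : (ζ : ℝ) ≤ 1 / 32 * t) (E₀ : ErrorBounds) {δ lam : ℝ} (hδ : 0 < δ) (hδ1 : δ < 1)
    (hlam : lam = Real.log (3 * t * d * L / δ))
    (hn : 2 ^ 20 * k * lam ≤ (m / (2 * L) : ℕ))
    (hN : 2 ^ 20 * (d * √(k : ℝ)) * lam ≤ t * (m / (2 * L) : ℕ))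
    {E : ErrorBounds} (hE : E = (ErrorBounds.next (1 / 32) 2 (1 / 16) k)^[ℓ] E₀)
    (hα0 : 0 ≤ E.α) (hγ0 : 0 ≤ E.γ) (hβ0 : 0 ≤ E.β) (hτ0 : 0 ≤ E.τ)
    (hα : E.α ≤ √(k : ℝ) * E.γ) :
    ∃ Bad : Set (Fin t → Fin m → Fin d → ℝ), (covariateLaw t m d).real Bad ≤ 4 * δ / L ∧
      ∀ x ∉ Bad,
        E.Valid (run (1 / 32) 2 (1 / 16) k L E₀ w ustar bstar x ℓ).u
          (run (1 / 32) 2 (1 / 16) k L E₀ w ustar bstar x ℓ).b (w • ustar) bstar →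
        (E.next (1 / 32) 2 (1 / 16) k).Valid
          (run (1 / 32) 2 (1 / 16) k L E₀ w ustar bstar x (ℓ + 1)).u
          (run (1 / 32) 2 (1 / 16) k L E₀ w ustar bstar x (ℓ + 1)).b (w • ustar) bstar := by
  have hk1 : (1 : ℝ) ≤ k := by exact_mod_cast hk
  have ht1 : (1 : ℝ) ≤ t := by exact_mod_cast ht
  have hsk : 1 ≤ √(k : ℝ) := Real.one_le_sqrt.mpr hk1
  obtain ⟨hlam1, hbudget⟩ := union_budget ht hd (by omega : 0 < L) hδ hδ1 hlam
  set n : ℕ := m / (2 * L) with hnd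
  have hnpos : (0 : ℝ) < n := lt_of_lt_of_le (by positivity) hn
  have hn' : 0 < n := by exact_mod_cast hnpos
  have hN1 : 2 ^ 20 * k * lam ≤ t * (n : ℝ) := by nlinarith
  set N : ℝ := t * n with hNdef
  have hNpos : 0 < N := by positivity
  have hc1 : (batch m L (2 * ℓ)).card = n := card_batch (by omega)
  have hc2 : (batch m L (2 * ℓ + 1)).card = n := card_batch (by omega)
  set γ' := E.nextGamma (1 / 32) k with hγ'
  have hγ'0 : 0 ≤ γ' := by rw [hγ', ErrorBounds.nextGamma]; positivity
  set μ := covariateLaw t m d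
  set R := fun x : Fin t → Fin m → Fin d → ℝ => run (1 / 32) 2 (1 / 16) k L E₀ w ustar bstar x
  set Q₁ : (Fin t → Fin m → Fin d → ℝ) → Fin t → Fin d → ℝ := fun x i =>
    ((R x ℓ).u - w • ustar) + ((R x ℓ).b i - bstar i) with hQ₁
  set Q₂ : (Fin t → Fin m → Fin d → ℝ) → Fin t → Fin d → ℝ := fun x i =>
    bstar i - (R x (ℓ + 1)).b i - taskMean (fun i => bstar i - (R x (ℓ + 1)).b i) with hQ₂
  obtain ⟨hum, hbm⟩ := measurable_run (t := t) (m := m) (c₁ := 1 / 32) (c₂ := 2) (c₃ := 1 / 16)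
    (k := k) (L := L) (E₀ := E₀) (w := w) (ustar := ustar) (bstar := bstar) ℓ
  have hbm' := (measurable_run (t := t) (m := m) (c₁ := 1 / 32) (c₂ := 2) (c₃ := 1 / 16)
    (k := k) (L := L) (E₀ := E₀) (w := w) (ustar := ustar) (bstar := bstar) (ℓ + 1)).2
  have hQ₁m : Measurable Q₁ := by
    refine measurable_pi_iff.mpr fun i => measurable_pi_iff.mpr fun s => ?_
    simp only [hQ₁, Pi.add_apply, Pi.sub_apply]
    fun_prop
  have hQ₂m : Measurable Q₂ := by
    refine measurable_pi_iff.mpr fun i => measurable_pi_iff.mpr fun s => ?_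
    simp only [hQ₂, taskMean, Pi.sub_apply, Pi.smul_apply, Finset.sum_apply, smul_eq_mul]
    fun_prop
  have hmask : ∀ q, 2 * ℓ ≤ q → ∀ x, (R (mask (batchesBefore m L q) x) ℓ).u = (R x ℓ).u ∧
      (R (mask (batchesBefore m L q) x) ℓ).b = (R x ℓ).b := fun q hq x =>
    run_mask (fun q' hq' => batch_subset_batchesBefore (by omega)) x
  have hQ₁mask : ∀ x, Q₁ (mask (batchesBefore m L (2 * ℓ)) x) = Q₁ x := by
    intro x
    obtain ⟨h1, h2⟩ := hmask (2 * ℓ) le_rfl x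
    simp only [hQ₁, h1, h2]
  have hQ₂mask : ∀ x, Q₂ (mask (batchesBefore m L (2 * ℓ + 1)) x) = Q₂ x := by
    intro x
    obtain ⟨h1, h2⟩ := hmask (2 * ℓ + 1) (by omega) x
    have h3 : (R (mask (batchesBefore m L (2 * ℓ + 1)) x) (ℓ + 1)).b = (R x (ℓ + 1)).b :=
      run_b_mask_succ (batch_subset_batchesBefore (by omega)) x h1 h2
    simp only [hQ₂, h3]
  obtain ⟨p1, p2, -, -⟩ := tail_parameter_bounds hlam1 hk hd hN1 hN
  set θb := √(160 * d * lam / N)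
  set θc := √(32 * lam / N)
  have hθc1 : θc ≤ 1 := by nlinarith [Real.sqrt_nonneg (32 * lam / N)]
  -- The norm bounds on the random vectors are part of the events, so the probability estimates need
  -- no conditioning on earlier success; validity of the current bounds is used only outside the bad
  -- set.
  set A : Fin t × Fin d → Set (Fin t → Fin m → Fin d → ℝ) := fun is =>
    {x | (∀ i ∈ ({is.1} : Finset (Fin t)), l2norm (Q₁ x i) ≤ E.τ + E.α) ∧
      1 / 32 / √(k : ℝ) * (E.τ + E.α) *
        ((({is.1} : Finset (Fin t)).card : ℝ) * (batch m L (2 * ℓ)).card) <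
        |∑ i ∈ ({is.1} : Finset (Fin t)), ∑ j ∈ batch m L (2 * ℓ),
          ((x i j ⬝ᵥ Pi.single is.2 1) * (x i j ⬝ᵥ Q₁ x i) - Pi.single is.2 1 ⬝ᵥ Q₁ x i)|} with hA
  set G : (Fin d → ℤ) → (Fin d → ℤ) → Set (Fin t → Fin m → Fin d → ℝ) := fun a a' =>
    {x | (∀ i ∈ (Finset.univ : Finset (Fin t)), l2norm (gridPoint a') ≤ 1) ∧
      θb * 1 * (((Finset.univ : Finset (Fin t)).card : ℝ) * (batch m L (2 * ℓ + 1)).card) <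
        |∑ i, ∑ j ∈ batch m L (2 * ℓ + 1),
          ((x i j ⬝ᵥ gridPoint a) * (x i j ⬝ᵥ gridPoint a') - gridPoint a ⬝ᵥ gridPoint a')|}
    with hG
  set D : Fin d → Set (Fin t → Fin m → Fin d → ℝ) := fun s =>
    {x | (∀ i ∈ (Finset.univ : Finset (Fin t)), l2norm (Q₂ x i) ≤ 2 * √(k : ℝ) * γ') ∧
      θc * (2 * √(k : ℝ) * γ') *
        (((Finset.univ : Finset (Fin t)).card : ℝ) * (batch m L (2 * ℓ + 1)).card) <
        |∑ i, ∑ j ∈ batch m L (2 * ℓ + 1),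
          ((x i j ⬝ᵥ Pi.single s 1) * (x i j ⬝ᵥ Q₂ x i) - Pi.single s 1 ⬝ᵥ Q₂ x i)|} with hD
  have hAμ : ∀ is, μ.real (A is) ≤ 4 * Real.exp (-lam) := by
    intro is
    refine (fresh_bilinear_tail (disjoint_batchesBefore (2 * ℓ)) {is.1} (l2norm_single_one is.2)
      hQ₁m hQ₁mask (by positivity) (by positivity) ?_).trans ?_
    · rw [div_le_one (by positivity)]; linarith
    · rw [hc1, Finset.card_singleton, div_pow, Real.sq_sqrt (by positivity)]
      gcongr
      -- The exponent is `n / (2 ^ 15 * k)`, and `n ≥ 2 ^ 20 * k * lam`.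
      rw [Nat.cast_one, one_mul, div_mul_eq_mul_div, div_div, le_div_iff₀ (by positivity)]
      nlinarith
  have hGμ : ∀ a a', l2norm (gridPoint a) ≤ 1 → μ.real (G a a') ≤
      4 * Real.exp (-(5 * d * lam)) := by
    intro a a' ha
    -- Grid points are deterministic, so the set of earlier samples can be empty.
    refine (fresh_bilinear_tail (Finset.disjoint_empty_left _) Finset.univ ha
      (Q := fun _ _ => gridPoint a') measurable_const (fun _ => rfl) zero_le_one
      (Real.sqrt_nonneg _) (by linarith)).trans ?_
    rw [hc2, Finset.card_univ, Fintype.card_fin, Real.sq_sqrt (by positivity), ← hNdef]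
    gcongr
    rw [div_mul_cancel₀ _ hNpos.ne']
    linarith
  have hDμ : ∀ s, μ.real (D s) ≤ 4 * Real.exp (-lam) := by
    intro s
    refine (fresh_bilinear_tail (disjoint_batchesBefore (2 * ℓ + 1)) Finset.univ
      (l2norm_single_one s) hQ₂m hQ₂mask (by positivity) (Real.sqrt_nonneg _) hθc1).trans ?_
    rw [hc2, Finset.card_univ, Fintype.card_fin, Real.sq_sqrt (by positivity), ← hNdef]
    gcongr
    rw [div_mul_cancel₀ _ hNpos.ne']
    linarith
  set F := (gridIndex d).filter fun a => l2norm (gridPoint a) ≤ 1 with hF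
  have hFc : (F.card : ℝ) ≤ (8 * d + 1 : ℝ) ^ d := by
    have : F.card ≤ (8 * d + 1) ^ d := (Finset.card_filter_le _ _).trans card_gridIndex.le
    exact_mod_cast this
  refine ⟨((⋃ is ∈ (Finset.univ : Finset (Fin t × Fin d)), A is) ∪
    ⋃ aa ∈ F ×ˢ F, G aa.1 aa.2) ∪ ⋃ s ∈ (Finset.univ : Finset (Fin d)), D s, ?_, ?_⟩
  · refine (measureReal_union_le _ _).trans (le_trans (add_le_add
      ((measureReal_union_le _ _).trans (add_le_add ?_ ?_)) ?_) hbudget)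
    · refine (measureReal_biUnion_finset_le _ _).trans
        ((Finset.sum_le_sum fun is _ => hAμ is).trans ?_)
      simp
    · refine (measureReal_biUnion_finset_le _ _).trans ((Finset.sum_le_sum fun aa haa =>
        hGμ aa.1 aa.2 (Finset.mem_filter.mp (Finset.mem_product.mp haa).1).2).trans ?_)
      rw [Finset.sum_const, nsmul_eq_mul, Finset.card_product, Nat.cast_mul]
      gcongr
    · refine (measureReal_biUnion_finset_le _ _).trans
        ((Finset.sum_le_sum fun s _ => hDμ s).trans ?_)
      simp
  · intro x hx hvalid
    simp only [Set.mem_union, Set.mem_iUnion, not_or, not_exists, Finset.mem_univ,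
      forall_true_left] at hx
    obtain ⟨⟨hxA, hxG⟩, hxD⟩ := hx
    have hb : ∀ i s, (bstar i s = 0 → (R x (ℓ + 1)).b i s = 0) ∧
        |(R x (ℓ + 1)).b i s - bstar i s| ≤ γ' := by
      intro i s
      have h := gradient_update_error (x := x) (J := batch m L (2 * ℓ)) (c₁ := 1 / 32)
        (by omega) hk (by norm_num) hvalid hα (by
          intro i s hl
          have h1 := hxA (i, s)
          simp only [hA, Set.mem_ofPred_eq, Finset.mem_singleton, forall_eq,
            Finset.sum_singleton, Finset.card_singleton, Nat.cast_one, one_mul,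
            dotProduct_single_one, single_one_dotProduct, not_and, not_lt] at h1
          exact h1 hl) i s
      have hrw : (R x (ℓ + 1)).b i = _ := run_b_succ x ℓ i
      rw [hrw, ← hE]
      exact h
    obtain ⟨hu1, hu2⟩ := leastSquares_update_error ht hd hk (us := w • ustar) hsparse hζ
      (J := batch m L (2 * ℓ + 1)) (x := x) hγ'0 hlam1 (by rw [hc2]; exact hN1)
      (by rw [hc2]; exact hN) hb (by
        intro a ha a' ha' h1 h1'
        have h2 := hxG (a, a') (Finset.mem_product.mpr ⟨Finset.mem_filter.mpr ⟨ha, h1⟩,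
          Finset.mem_filter.mpr ⟨ha', h1'⟩⟩)
        simp only [hG, Set.mem_ofPred_eq, Finset.card_univ, Fintype.card_fin, mul_one,
          not_and, not_lt] at h2
        have h3 := h2 (fun _ _ => h1')
        rw [hc2] at h3 ⊢
        exact h3) (by
        intro s hl
        have h2 := hxD s
        simp only [hD, Set.mem_ofPred_eq, Finset.card_univ, Fintype.card_fin,
          dotProduct_single_one, single_one_dotProduct, not_and, not_lt] at h2
        have h3 := h2 (fun i _ => hl i)
        rw [hc2] at h3 ⊢
        exact h3)
    refine ⟨fun i => ?_, fun i => ?_, hu1, hu2⟩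
    · refine l2norm_le_of_sparse hγ'0 (fun s => (hb i s).2) (hsparse.2 i) fun s hs => ?_
      rw [Pi.sub_apply, hs, (hb i s).1 hs, sub_zero]
    · exact norm_le_of_abs_le hγ'0 fun s => (hb i s).2

/-! ### Contraction of the error bounds. -/

/-- Along the iteration the error bounds contract by the factor `e`. -/
lemma nextGamma_iterate_le {k : ℕ} (hk : 0 < k) {E₀ : ErrorBounds} (hγ : 0 ≤ E₀.γ)
    (hβ : 0 ≤ E₀.β) (hτ : 0 ≤ E₀.τ) (hα : E₀.α ≤ √(k : ℝ) * E₀.γ) (hα0 : 0 ≤ E₀.α) (ℓ : ℕ) :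
    let E := (ErrorBounds.next (1 / 32) 2 (1 / 16) k)^[ℓ] E₀
    0 ≤ E.α ∧ 0 ≤ E.γ ∧ 0 ≤ E.β ∧ 0 ≤ E.τ ∧ E.α ≤ √(k : ℝ) * E.γ ∧
      E.γ ≤ 6 * (E₀.γ + E₀.β + E₀.τ / √(k : ℝ)) * Real.exp (-ℓ) ∧
      E.β ≤ 6 * (E₀.γ + E₀.β + E₀.τ / √(k : ℝ)) * Real.exp (-ℓ) := by
  have hsk : 0 < √(k : ℝ) := by positivity
  have he := Real.exp_one_lt_d9
  have hem : (1 : ℝ) / 3 ≤ Real.exp (-1) := by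
    rw [Real.exp_neg, one_div]
    exact inv_anti₀ (Real.exp_pos 1) (by linarith)
  set g := E₀.γ + E₀.β + E₀.τ / √(k : ℝ) with hg
  have hτk : 0 ≤ E₀.τ / √(k : ℝ) := by positivity
  have hg0 : 0 ≤ g := by positivity
  have hnext : ∀ (E : ErrorBounds) (r : ℝ), 0 ≤ E.γ → 0 ≤ E.β → 0 ≤ E.τ → 0 ≤ r →
      E.nextGamma (1 / 32) k ≤ r → 0 ≤ E.nextGamma (1 / 32) k →
      0 ≤ (E.next (1 / 32) 2 (1 / 16) k).α ∧ 0 ≤ (E.next (1 / 32) 2 (1 / 16) k).γ ∧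
      0 ≤ (E.next (1 / 32) 2 (1 / 16) k).β ∧ 0 ≤ (E.next (1 / 32) 2 (1 / 16) k).τ ∧
      (E.next (1 / 32) 2 (1 / 16) k).α ≤ √(k : ℝ) * (E.next (1 / 32) 2 (1 / 16) k).γ ∧
      (E.next (1 / 32) 2 (1 / 16) k).γ ≤ r ∧ (E.next (1 / 32) 2 (1 / 16) k).β ≤ r := by
    intro E r _ _ _ hr h1 h0
    refine ⟨by simp only [ErrorBounds.next]; positivity, h0,
      by simp only [ErrorBounds.next]; positivity, by simp only [ErrorBounds.next]; positivity,
      le_rfl, h1, ?_⟩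
    simp only [ErrorBounds.next]
    linarith
  have hng : ∀ E : ErrorBounds, 0 ≤ E.γ → 0 ≤ E.β → 0 ≤ E.τ → 0 ≤ E.nextGamma (1 / 32) k := by
    intro E h1 h2 h3
    rw [ErrorBounds.nextGamma]
    positivity
  have hfirst : E₀.nextGamma (1 / 32) k ≤ 2 * g := by
    have : 2 * (1 / 32) / √(k : ℝ) * E₀.τ = 1 / 16 * (E₀.τ / √(k : ℝ)) := by ring
    rw [ErrorBounds.nextGamma, this, hg]
    linarith
  induction ℓ with
  | zero =>
    simp only [Function.iterate_zero, id, Nat.cast_zero, neg_zero, Real.exp_zero, mul_one]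
    refine ⟨hα0, hγ, hβ, hτ, hα, ?_, ?_⟩ <;> rw [hg] <;> nlinarith
  | succ ℓ ih =>
    have hexp : Real.exp (-(ℓ + 1 : ℕ)) = Real.exp (-ℓ) * Real.exp (-1) := by
      rw [← Real.exp_add]; congr 1; push_cast; ring
    have hpos := Real.exp_pos (-(ℓ : ℝ))
    simp only [Function.iterate_succ_apply']
    cases ℓ with
    | zero =>
      refine hnext _ _ hγ hβ hτ (by positivity) ?_ (hng _ hγ hβ hτ)
      -- The initial bounds need not satisfy the relations `τ = c₂ √k γ` and `β = c₃ γ`, so the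
      -- first step may double `g`. The constant 6 is this 2 times 3, with `3 ≥ e`.
      refine hfirst.trans ?_
      rw [hexp, Nat.cast_zero, neg_zero, Real.exp_zero, one_mul]
      nlinarith
    | succ ℓ =>
      obtain ⟨-, i2, i3, i4, -, i6, -⟩ := ih
      refine hnext _ _ i2 i3 i4 (by positivity) ?_ (hng _ i2 i3 i4)
      rw [hexp]
      rw [Function.iterate_succ_apply'] at i2 i6 ⊢
      set E := (ErrorBounds.next (1 / 32) 2 (1 / 16) k)^[ℓ] E₀
      have hid : (E.next (1 / 32) 2 (1 / 16) k).nextGamma (1 / 32) k =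
          5 / 16 * (E.next (1 / 32) 2 (1 / 16) k).γ := by
        simp only [ErrorBounds.nextGamma, ErrorBounds.next]
        field_simp
        ring
      rw [hid]
      have h1 : 5 / 16 * (E.next (1 / 32) 2 (1 / 16) k).γ ≤
          Real.exp (-1) * (E.next (1 / 32) 2 (1 / 16) k).γ := by
        gcongr; linarith
      refine h1.trans ?_
      rw [← mul_assoc, mul_comm]
      gcongr

end SparseFineTuning

end

/-! ### The main theorem. -/

theorem theorem4 :
    ∃ c₀ c₁ c₂ c₃ C : ℝ, 0 < c₀ ∧ 0 < c₁ ∧ 0 < c₂ ∧ 0 < c₃ ∧ 0 < C ∧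
      ∀ (t m d k ζ L : ℕ) (w : ℝ) (ustar : Fin d → ℝ) (bstar : Fin t → Fin d → ℝ)
        (E₀ : SparseFineTuning.ErrorBounds) (ε₀ δ₀ : ℝ),
        0 < t → 0 < k → 0 < ε₀ → 0 < δ₀ → δ₀ < 1 →
        SparseFineTuning.RowColSparse bstar ζ k →
        (ζ : ℝ) ≤ c₀ * t →
        E₀.Valid 0 0 (w • ustar) bstar →
        E₀.α ≤ √(k : ℝ) * E₀.γ →
        Real.log (ε₀⁻¹ * (E₀.γ + E₀.β + E₀.τ / √(k : ℝ))) ≤ L →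
        C * L * Real.log (3 * t * d * L / δ₀) * k ≤ m →
        C * L * Real.log (3 * t * d * L / δ₀) * (d * √(k : ℝ)) ≤ m * t →
        C * L * Real.log (3 * t * d * L / δ₀) * (ζ * k * d) ≤ m * t ^ 2 →
        1 - C * δ₀ ≤ (SparseFineTuning.covariateLaw t m d).real
          {x | let out := SparseFineTuning.iterate c₁ c₂ c₃ k L E₀ x
                  (SparseFineTuning.responses w ustar bstar x) L
               ‖out.u - w • ustar‖ ≤ C * ε₀ ∧ ∀ i, ‖out.b i - bstar i‖ ≤ C * ε₀} := by
  open SparseFineTuning MeasureTheory in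
  refine ⟨1 / 32, 1 / 32, 2, 1 / 16, 2 ^ 22, by norm_num, by norm_num, by norm_num, by norm_num,
    by norm_num, ?_⟩
  intro t m d k ζ L w ustar bstar E₀ ε₀ δ₀ ht hk hε hδ hδ1 hsparse hζ hvalid hα hL hm hmt _
  set μ := covariateLaw t m d
  set good : Set (Fin t → Fin m → Fin d → ℝ) :=
    {x | let out := iterate (1 / 32) 2 (1 / 16) k L E₀ x (responses w ustar bstar x) L
         ‖out.u - w • ustar‖ ≤ 2 ^ 22 * ε₀ ∧ ∀ i, ‖out.b i - bstar i‖ ≤ 2 ^ 22 * ε₀} with hgood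
  obtain ⟨hα0, hγ0, hβ0, hτ0⟩ := hvalid.nonneg ht
  have hbounds := nextGamma_iterate_le hk hγ0 hβ0 hτ0 hα hα0
  set g := E₀.γ + E₀.β + E₀.τ / √(k : ℝ) with hg
  have hg0 : 0 ≤ g := by positivity
  have hfinal : 6 * g * Real.exp (-L) ≤ 2 ^ 22 * ε₀ := by
    have : g * Real.exp (-L) ≤ ε₀ := by
      -- For `g = 0` the convention `Real.log 0 = 0` makes `hL` void, but then the bounds vanish
      -- from the start.
      rcases hg0.eq_or_lt with h0 | h0
      · rw [← h0, zero_mul]; exact hε.le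
      · rw [Real.log_le_iff_le_exp (by positivity), inv_mul_le_iff₀ hε] at hL
        rw [Real.exp_neg, ← div_eq_mul_inv, div_le_iff₀ (Real.exp_pos _)]
        exact hL
    linarith
  have hgoodmem : ∀ x, ((ErrorBounds.next (1 / 32) 2 (1 / 16) k)^[L] E₀).Valid
      (run (1 / 32) 2 (1 / 16) k L E₀ w ustar bstar x L).u
      (run (1 / 32) 2 (1 / 16) k L E₀ w ustar bstar x L).b (w • ustar) bstar → x ∈ good := by
    intro x hx
    obtain ⟨-, -, -, -, -, h6, h7⟩ := hbounds L
    exact ⟨hx.2.2.1.trans (h7.trans hfinal), fun i => (hx.2.1 i).trans (h6.trans hfinal)⟩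
  have hbad : ∃ Bad : Set (Fin t → Fin m → Fin d → ℝ), μ.real Bad ≤ 4 * δ₀ ∧
      ∀ x ∉ Bad, x ∈ good := by
    -- For `d = 0` or `L = 0` the logarithm is degenerate and `union_budget` does not apply; the
    -- claim then holds for every sample.
    rcases Nat.eq_zero_or_pos d with rfl | hd
    · refine ⟨∅, by simp; positivity, fun x _ => ⟨?_, fun i => ?_⟩⟩
      · rw [Subsingleton.elim (_ - w • ustar) 0, norm_zero]; positivity
      · rw [Subsingleton.elim (_ - bstar i) 0, norm_zero]; positivity
    rcases Nat.eq_zero_or_pos L with rfl | hLpos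
    · exact ⟨∅, by simp; positivity, fun x _ => hgoodmem x hvalid⟩
    set lam := Real.log (3 * t * d * L / δ₀) with hlam
    obtain ⟨hlam1, -⟩ := union_budget ht hd hLpos hδ hδ1 hlam
    have hL1 : (1 : ℝ) ≤ L := by exact_mod_cast hLpos
    have hk1 : (1 : ℝ) ≤ k := by exact_mod_cast hk
    have ht1 : (1 : ℝ) ≤ t := by exact_mod_cast ht
    -- Since `m ≥ 4 * L`, the floor loses at most a factor 2. This turns `2 ^ 22` into the `2 ^ 20`
    -- required per batch.
    have hdiv : (m : ℝ) ≤ 4 * L * (m / (2 * L) : ℕ) := by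
      have h1 : (m : ℝ) < (2 * L : ℕ) * ((m / (2 * L) : ℕ) + 1) := by
        exact_mod_cast Nat.lt_mul_div_succ m (by omega : 0 < 2 * L)
      have h2 : 4 * (L : ℝ) ≤ m := by
        refine le_trans ?_ hm
        have h3 : 1 ≤ lam * k := one_le_mul_of_one_le_of_one_le hlam1 hk1
        calc 4 * (L : ℝ) ≤ 2 ^ 22 * L * 1 := by nlinarith
          _ ≤ 2 ^ 22 * L * (lam * k) := by gcongr
          _ = _ := by ring
      push_cast at h1
      linarith
    have hn : 2 ^ 20 * k * lam ≤ (m / (2 * L) : ℕ) := by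
      have h := hm.trans hdiv
      refine le_of_mul_le_mul_left ?_ (show (0 : ℝ) < 4 * L by positivity)
      calc _ = 2 ^ 22 * L * lam * k := by ring
        _ ≤ _ := h
    have hN : 2 ^ 20 * (d * √(k : ℝ)) * lam ≤ t * (m / (2 * L) : ℕ) := by
      have h := hmt.trans (mul_le_mul_of_nonneg_right hdiv (by positivity : (0 : ℝ) ≤ t))
      refine le_of_mul_le_mul_left ?_ (show (0 : ℝ) < 4 * L by positivity)
      calc _ = 2 ^ 22 * L * lam * (d * √(k : ℝ)) := by ring
        _ ≤ _ := h
        _ = _ := by ring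
    have hstep : ∀ ℓ : Fin L, _ := fun ℓ =>
      exists_bad_event (m := m) ℓ.2 ht hd hk w ustar hsparse hζ E₀ hδ hδ1 hlam hn hN rfl
        (hbounds ℓ).1 (hbounds ℓ).2.1 (hbounds ℓ).2.2.1 (hbounds ℓ).2.2.2.1
        (hbounds ℓ).2.2.2.2.1
    choose Bad hBμ hB using hstep
    refine ⟨⋃ ℓ ∈ (Finset.univ : Finset (Fin L)), Bad ℓ, ?_, fun x hx => hgoodmem x ?_⟩
    · refine (measureReal_biUnion_finset_le _ _).trans
        ((Finset.sum_le_sum fun ℓ _ => hBμ ℓ).trans (le_of_eq ?_))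
      simp only [Finset.sum_const, Finset.card_univ, Fintype.card_fin, nsmul_eq_mul]
      field_simp
    · simp only [Set.mem_iUnion, Finset.mem_univ, exists_true_left, not_exists] at hx
      have hall : ∀ ℓ ≤ L, ((ErrorBounds.next (1 / 32) 2 (1 / 16) k)^[ℓ] E₀).Valid
          (run (1 / 32) 2 (1 / 16) k L E₀ w ustar bstar x ℓ).u
          (run (1 / 32) 2 (1 / 16) k L E₀ w ustar bstar x ℓ).b (w • ustar) bstar := by
        intro ℓ
        induction ℓ with
        | zero => exact fun _ => hvalid
        | succ ℓ ih =>
          intro hℓ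
          rw [Function.iterate_succ_apply']
          exact hB ⟨ℓ, hℓ⟩ x (hx _) (ih (by omega))
      exact hall L le_rfl
  obtain ⟨Bad, hBad, hBg⟩ := hbad
  have huniv : (1 : ℝ) ≤ μ.real good + μ.real Bad := by
    calc (1 : ℝ) = μ.real Set.univ := by simp
      _ ≤ μ.real (good ∪ Bad) := measureReal_mono fun x _ => by
        by_cases hx : x ∈ Bad
        · exact Or.inr hx
        · exact Or.inl (hBg x hx)
      _ ≤ _ := measureReal_union_le _ _
  linarith
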